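/- **Theorem (Tameness of central lines).** Let $\mathbb{P}^1=\mathbb{C}\cup\{\infty\}$ be the Riemann sphere with its chordal metric, and fix $L>0$. Let $S=\{x+iy : |y|<L\}$ be the standard strip and $T:S\to S$, $T(z)=z-1$. For a rational map $f:\mathbb{P}^1\to\mathbb{P}^1$, an *invariant strip* of $f$ is an open simply connected set $A\subset\mathbb{P}^1$ such that $f|_A$ is holomorphically conjugate to $T$ on $S$, i.e. there is a conformal isomorphism $h:S\to A$ with $f\circ h=h\circ T$. The *central line* of $A$ is the unique hyperbolic geodesic $\gamma$ of $A$ with $f(\gamma)=\gamma$. Let $f_n$ $(n\in\mathbb{N})$ and $g$ be rational maps of degree at least $2$ with $f_n\to g$ uniformly on $\mathbb{P}^1$. For each $n$ let $A_n$ be an invariant strip of $f_n$ with central line $\gamma_n$, and suppose that $\overline{\gamma_n}\to\Gamma$ in the Hausdorff topology on compact subsets of $\mathbb{P}^1$. If $\Gamma$ is not a single point, then there is a non-empty, finite or countably infinite, family $\{S_e\}_{e\in E}$ of pairwise disjoint invariant strips of $g$ (for the same $L$), with central lines $\gamma_e$, such that $$\Gamma\setminus\mathrm{Fix}(g)=\bigcup_{e\in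 E}\gamma_e\qquad\text{and}\qquad \Gamma=\bigcup_{e\in E}\overline{\gamma_e},$$ where $\mathrm{Fix}(g)=\{z\in\mathbb{P}^1 : g(z)=z\}$. -/

import Mathlib

open Set Filter Topology

noncomputable section

namespace RiemannSphere

/-- Stereographic projection of the Riemann sphere `OnePoint ℂ` to the unit sphere of
`ℂ × ℝ` (with its Euclidean norm), sending `∞` to the north pole. -/
def stereo (p : OnePoint ℂ) : WithLp 2 (ℂ × ℝ) :=
  p.elim (WithLp.toLp 2 (0, 1)) fun z =>
    WithLp.toLp 2 ((2 / (1 + ‖z‖ ^ 2) : ℝ) • z, 1 - 2 / (1 + ‖z‖ ^ 2))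

theorem continuous_stereo : Continuous stereo := by
  rw [OnePoint.continuous_iff]
  have hpos : ∀ z : ℂ, (1 + ‖z‖ ^ 2 : ℝ) ≠ 0 := fun z => by positivity
  constructor
  · rw [coclosedCompact_eq_cocompact]
    have hn : Tendsto (fun z : ℂ => ‖z‖) (cocompact ℂ) atTop := tendsto_norm_cocompact_atTop
    have h1 : Tendsto (fun z : ℂ => 2 / (1 + ‖z‖ ^ 2)) (cocompact ℂ) (𝓝 0) :=
      Tendsto.const_div_atTop
        (tendsto_atTop_add_const_left _ _ ((tendsto_pow_atTop two_ne_zero).comp hn)) 2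
    have h2 : Tendsto (fun z : ℂ => (2 / (1 + ‖z‖ ^ 2) : ℝ) • z) (cocompact ℂ) (𝓝 0) := by
      rw [tendsto_zero_iff_norm_tendsto_zero]
      have h3 : Tendsto (fun z : ℂ => 2 / ‖z‖) (cocompact ℂ) (𝓝 0) := hn.const_div_atTop 2
      refine squeeze_zero (fun z => norm_nonneg _) (fun z => ?_) h3
      rw [norm_smul, Real.norm_of_nonneg (by positivity)]
      rcases eq_or_ne z 0 with rfl | hz
      · simp
      · have : 0 < ‖z‖ := norm_pos_iff.2 hz
        rw [div_mul_eq_mul_div, div_le_div_iff₀ (by positivity) this]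
        nlinarith
    have h4 : Tendsto (fun z : ℂ => ((2 / (1 + ‖z‖ ^ 2) : ℝ) • z, 1 - 2 / (1 + ‖z‖ ^ 2)))
        (cocompact ℂ) (𝓝 ((0 : ℂ), (1 : ℝ))) := by
      refine h2.prodMk_nhds ?_
      simpa using h1.const_sub 1
    exact ((WithLp.prod_continuous_toLp 2 ℂ ℝ).tendsto _).comp h4
  · refine (WithLp.prod_continuous_toLp 2 ℂ ℝ).comp ?_
    fun_prop (disch := exact hpos _)

theorem stereo_injective : Function.Injective stereo := by
  have hpos : ∀ z : ℂ, (0 : ℝ) < 2 / (1 + ‖z‖ ^ 2) := fun z => by positivity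
  intro p q h
  induction p using OnePoint.rec with
  | infty =>
    induction q using OnePoint.rec with
    | infty => rfl
    | coe w =>
      have h1 : (1 : ℝ) = 1 - 2 / (1 + ‖w‖ ^ 2) :=
        congrArg (fun v : WithLp 2 (ℂ × ℝ) => v.snd) h
      have := hpos w
      linarith
  | coe z =>
    induction q using OnePoint.rec with
    | infty =>
      have h1 : 1 - 2 / (1 + ‖z‖ ^ 2) = (1 : ℝ) :=
        congrArg (fun v : WithLp 2 (ℂ × ℝ) => v.snd) h
      have := hpos z
      linarith
    | coe w =>
      have h1 : (1 - 2 / (1 + ‖z‖ ^ 2) : ℝ) = 1 - 2 / (1 + ‖w‖ ^ 2) :=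
        congrArg (fun v : WithLp 2 (ℂ × ℝ) => v.snd) h
      have h2 : (2 / (1 + ‖z‖ ^ 2) : ℝ) • z = (2 / (1 + ‖w‖ ^ 2) : ℝ) • w :=
        congrArg (fun v : WithLp 2 (ℂ × ℝ) => v.fst) h
      have h3 : (2 / (1 + ‖z‖ ^ 2) : ℝ) = 2 / (1 + ‖w‖ ^ 2) := by linarith
      rw [h3] at h2
      exact congrArg _ (smul_right_injective ℂ (hpos w).ne' h2)

theorem isEmbedding_stereo : IsEmbedding stereo :=
  (continuous_stereo.isClosedEmbedding stereo_injective).isEmbedding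

/-- The chordal metric on the Riemann sphere. Its topology is definitionally the
topology of the one-point compactification. -/
instance instMetricSpaceSphere : MetricSpace (OnePoint ℂ) :=
  isEmbedding_stereo.comapMetricSpace stereo

/-- The point `[a : b]` of the projective line, for `(a, b) ≠ (0, 0)`. -/
def ratio (a b : ℂ) : OnePoint ℂ :=
  open Classical in if b = 0 then OnePoint.infty else ((a / b : ℂ) : OnePoint ℂ)

/-- `f` is a rational map of the Riemann sphere of degree `d`: in homogeneous coordinates
it is given by the coprime polynomials `p`, `q` homogenized in degree
`d = max (deg p) (deg q)`. -/
def IsRationalMap (d : ℕ) (f : OnePoint ℂ → OnePoint ℂ) : Prop :=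
  ∃ p q : Polynomial ℂ, IsCoprime p q ∧ max p.natDegree q.natDegree = d ∧
    (∀ z : ℂ, f z = ratio (p.eval z) (q.eval z)) ∧
    f OnePoint.infty = ratio (p.coeff d) (q.coeff d)

/-- The affine coordinate `z` (junk value `0` at `∞`). -/
def coordZero (p : OnePoint ℂ) : ℂ := p.elim 0 fun z => z

/-- The coordinate `1 / z` around `∞` (junk value `0` at `0`). -/
def coordInfty (p : OnePoint ℂ) : ℂ := p.elim 0 fun z => z⁻¹

/-- `h` is holomorphic on the open set `U ⊆ ℂ` as a map to the Riemann sphere: it is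
continuous, and holomorphic when read in the two standard charts of the sphere. -/
def HolomorphicOn (h : ℂ → OnePoint ℂ) (U : Set ℂ) : Prop :=
  ContinuousOn h U ∧ ∀ z ∈ U,
    (h z ≠ OnePoint.infty → DifferentiableAt ℂ (fun w => coordZero (h w)) z) ∧
    (h z ≠ ((0 : ℂ) : OnePoint ℂ) → DifferentiableAt ℂ (fun w => coordInfty (h w)) z)

/-- `h` restricts to a conformal isomorphism from the open set `U ⊆ ℂ` onto the subset `A`
of the Riemann sphere. -/
def IsConformalIso (h : ℂ → OnePoint ℂ) (U : Set ℂ) (A : Set (OnePoint ℂ)) : Prop :=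
  HolomorphicOn h U ∧ InjOn h U ∧ h '' U = A

/-- The standard strip `{x + i y : |y| < L}`. -/
def standardStrip (L : ℝ) : Set ℂ := {z | |z.im| < L}

/-- `A` is an invariant strip of `f` (with parameter `L`): it is open and simply connected, and
`f` restricted to `A` is holomorphically conjugate to `z ↦ z - 1` on the standard strip. -/
def IsInvariantStrip (L : ℝ) (f : OnePoint ℂ → OnePoint ℂ) (A : Set (OnePoint ℂ)) : Prop :=
  IsOpen A ∧ IsSimplyConnected A ∧
    ∃ h : ℂ → OnePoint ℂ, IsConformalIso h (standardStrip L) A ∧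
      ∀ z ∈ standardStrip L, f (h z) = h (z - 1)

/-- `γ` is a complete hyperbolic geodesic of the simply connected domain `A`: a uniformization
of `A` by the upper half-plane carries onto `γ` the image of an isometric embedding of the real
line in the upper half-plane with its hyperbolic distance. -/
def IsHyperbolicGeodesic (A γ : Set (OnePoint ℂ)) : Prop :=
  ∃ (φ : ℂ → OnePoint ℂ) (c : ℝ → UpperHalfPlane),
    IsConformalIso φ {z | 0 < z.im} A ∧ Isometry c ∧ γ = range fun t => φ (c t : ℂ)

/-- `γ` is the central line of the invariant strip `A` of `f`: the hyperbolic geodesic of `A`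
stabilized by `f`. -/
def IsCentralLine (f : OnePoint ℂ → OnePoint ℂ) (A γ : Set (OnePoint ℂ)) : Prop :=
  IsHyperbolicGeodesic A γ ∧ f '' γ = γ

end RiemannSphere

end

namespace RiemannSphere

/-! ### Charts of the sphere -/

/-! Parametrize `A n` by a strip map `h n`, so that `f n (h n z) = h n (z - 1)`. The central line is
then `h n` of the real axis, and the points of `Γ` are the limits of sequences `h n (t n)` with `t
n` real. The proof studies the limits of the translates `z ↦ h n (z + t n)`, all taken along one
fixed ultrafilter on the indices, so that no subsequences are needed.

Compactness: an injective strip map omits every point `a` with `f (f a) = f a`. A rational map of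
degree at least two has two such points, a fixed point and either a second fixed point or another
preimage of the first. By Hurwitz they persist, uniformly separated, for maps close to `g`. A Möbius
coordinate sending the two omitted points to `0` and `∞` turns a strip map into a nonvanishing
univalent function `F z * exp G`. Injectivity prevents the image of `G` from containing two points
that differ by `2πi`, so by Bloch's theorem the derivative of `G` is bounded. This gives locally
uniform Lipschitz bounds in the chordal metric (`HolomorphicOn.dist_le_of_injOn_of_omits`), hence
locally uniform convergence (`tendstoLocallyUniformlyOn_limitMap`).

Dichotomy: by Hurwitz a limit is injective, hence a strip map of `g`, or constant, and the constant
is a fixed point of `g` (`isStripMap_limitMap_or_const`). If the images of two injective limits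
meet, the translation parameters differ by a bounded amount, and the limits differ by a real
translation (`exists_translate_of_limitMap_eq`). So the distinct images are pairwise disjoint
strips.

Covering: a non-fixed point of `Γ` is the value at `0` of a limit, which cannot be constant;
conversely a strip map never takes a fixed value. For a fixed point `p` of `Γ`, take another point
`q` of `Γ`, walk along the lines from near `p` towards `q`, and stop on first leaving a small ball
around `p`. The limit based at the exit points is injective and half of its central line stays in
the ball; that end accumulates only at fixed points, hence at `p` (`exists_limitMap_mem_closure`).

The definition of a central line allows any uniformization. Schwarz-Pick in both directions makes
the transition to the standard one an isometry, and the only geodesic invariant under a homothety is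
the imaginary axis (`IsCentralLine.eq_range`). -/

@[simp] theorem coordZero_coe (z : ℂ) : coordZero (z : OnePoint ℂ) = z := rfl
@[simp] theorem coordZero_infty : coordZero OnePoint.infty = 0 := rfl
@[simp] theorem coordInfty_coe (z : ℂ) : coordInfty (z : OnePoint ℂ) = z⁻¹ := rfl
@[simp] theorem coordInfty_infty : coordInfty OnePoint.infty = 0 := rfl

/-- `κ` is a holomorphic chart of the sphere with the point `q` removed. -/
structure IsChart (κ : OnePoint ℂ → ℂ) (q : OnePoint ℂ) : Prop where
  continuousAt : ∀ p, p ≠ q → ContinuousAt κ p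
  injOn : InjOn κ {q}ᶜ
  differentiableAt : ∀ {h : ℂ → OnePoint ℂ} {U : Set ℂ} {z : ℂ}, HolomorphicOn h U → z ∈ U →
    h z ≠ q → DifferentiableAt ℂ (fun w => κ (h w)) z

theorem isChart_coordZero : IsChart coordZero OnePoint.infty where
  continuousAt p hp := by
    induction p using OnePoint.rec with
    | infty => exact absurd rfl hp
    | coe z =>
      rw [OnePoint.continuousAt_coe]
      exact continuousAt_id
  injOn p hp q hq h := by
    induction p using OnePoint.rec with
    | infty => exact absurd rfl hp
    | coe z =>
      induction q using OnePoint.rec with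
      | infty => exact absurd rfl hq
      | coe w => exact congrArg _ h
  differentiableAt hh hz hq := (hh.2 _ hz).1 hq

theorem isChart_coordInfty : IsChart coordInfty ((0 : ℂ) : OnePoint ℂ) where
  continuousAt p hp := by
    induction p using OnePoint.rec with
    | infty =>
      rw [OnePoint.continuousAt_infty', coclosedCompact_eq_cocompact, ← Metric.cobounded_eq_cocompact]
      exact tendsto_inv₀_cobounded
    | coe z =>
      rw [OnePoint.continuousAt_coe]
      exact continuousAt_inv₀ (fun h => hp (by rw [h]))
  injOn p hp q hq h := by
    induction p using OnePoint.rec with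
    | infty =>
      induction q using OnePoint.rec with
      | infty => rfl
      | coe w =>
        have : w ≠ 0 := fun h => hq (by rw [h]; rfl)
        simp at h; exact absurd h.symm this
    | coe z =>
      have hz : z ≠ 0 := fun h => hp (by rw [h]; rfl)
      induction q using OnePoint.rec with
      | infty => simp at h; exact absurd h hz
      | coe w => exact congrArg _ (inv_injective h)
  differentiableAt hh hz hq := (hh.2 _ hz).2 hq

theorem exists_isChart (p : OnePoint ℂ) : ∃ κ q, IsChart κ q ∧ p ≠ q := by
  by_cases hp : p = OnePoint.infty
  · exact ⟨_, _, isChart_coordInfty, by rw [hp]; exact OnePoint.infty_ne_coe _⟩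
  · exact ⟨_, _, isChart_coordZero, hp⟩

theorem holomorphicOn_const (p : OnePoint ℂ) (U : Set ℂ) : HolomorphicOn (fun _ => p) U :=
  ⟨continuousOn_const, fun _ _ =>
    ⟨fun _ => differentiableAt_const _, fun _ => differentiableAt_const _⟩⟩

theorem HolomorphicOn.comp {h : ℂ → OnePoint ℂ} {U V : Set ℂ} {ψ : ℂ → ℂ} (hh : HolomorphicOn h U)
    (hψ : ∀ z ∈ V, DifferentiableAt ℂ ψ z) (hm : MapsTo ψ V U) :
    HolomorphicOn (fun z => h (ψ z)) V := by
  refine ⟨hh.1.comp (fun z hz => (hψ z hz).continuousAt.continuousWithinAt) hm, fun z hz =>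
    ⟨fun hq => ?_, fun hq => ?_⟩⟩
  · exact ((hh.2 _ (hm hz)).1 hq).comp z (hψ z hz)
  · exact ((hh.2 _ (hm hz)).2 hq).comp z (hψ z hz)

theorem HolomorphicOn.mono {h : ℂ → OnePoint ℂ} {U V : Set ℂ} (hh : HolomorphicOn h U)
    (hV : V ⊆ U) : HolomorphicOn h V :=
  ⟨hh.1.mono hV, fun z hz => hh.2 z (hV hz)⟩

theorem HolomorphicOn.differentiableOn_chart {h : ℂ → OnePoint ℂ} {U : Set ℂ}
    {κ : OnePoint ℂ → ℂ} {q : OnePoint ℂ} (hκ : IsChart κ q) (hh : HolomorphicOn h U)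
    (hq : ∀ z ∈ U, h z ≠ q) : DifferentiableOn ℂ (fun w => κ (h w)) U :=
  fun z hz => (hκ.differentiableAt hh hz (hq z hz)).differentiableWithinAt

theorem eventually_closedBall_subset {U : Set ℂ} {z : ℂ} (hU : U ∈ 𝓝 z) :
    ∀ᶠ r in 𝓝[>] (0 : ℝ), Metric.closedBall z r ⊆ U := by
  obtain ⟨ε, hε, h⟩ := Metric.nhds_basis_closedBall.mem_iff.1 hU
  filter_upwards [Ioc_mem_nhdsGT hε] with r hr
  exact (Metric.closedBall_subset_closedBall hr.2).trans h

/-- Locally uniform convergence to the sphere becomes uniform convergence in a chart on small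
closed balls. -/
theorem IsChart.eventually_tendstoUniformlyOn {ι : Type*} {l : Filter ι} {κ : OnePoint ℂ → ℂ}
    {q : OnePoint ℂ} (hκ : IsChart κ q) {u : ι → ℂ → OnePoint ℂ} {h : ℂ → OnePoint ℂ} {U : Set ℂ}
    (hU : IsOpen U) (hl : TendstoLocallyUniformlyOn u h l U) (hc : ContinuousOn h U) {z : ℂ}
    (hz : z ∈ U) (hq : h z ≠ q) :
    ∀ᶠ r in 𝓝[>] (0 : ℝ), Metric.closedBall z r ⊆ U ∧ (∀ w ∈ Metric.closedBall z r, h w ≠ q) ∧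
      (∀ᶠ i in l, ∀ w ∈ Metric.closedBall z r, u i w ≠ q) ∧
      TendstoUniformlyOn (fun i w => κ (u i w)) (fun w => κ (h w)) l (Metric.closedBall z r) := by
  set δ := dist (h z) q
  have hδ : 0 < δ := dist_pos.2 hq
  -- The chart is continuous only off `q`; on the compact set of points at distance at least `δ / 2`
  -- from `q` it is uniformly continuous, so it preserves uniform convergence there.
  set K : Set (OnePoint ℂ) := {p | δ / 2 ≤ dist p q}
  have hK : IsCompact K :=
    (isClosed_le continuous_const (continuous_id.dist continuous_const)).isCompact
  have hKq : ∀ p ∈ K, p ≠ q := by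
    rintro p hp rfl
    have : δ / 2 ≤ dist p p := hp
    rw [dist_self] at this
    linarith
  have hcK : UniformContinuousOn κ K := hK.uniformContinuousOn_of_continuous fun p hp =>
    (hκ.continuousAt p (hKq p hp)).continuousWithinAt
  have hnear : {w | w ∈ U ∧ dist (h w) (h z) < δ / 4} ∈ 𝓝 z := by
    filter_upwards [hU.mem_nhds hz, (hc.continuousAt (hU.mem_nhds hz)).eventually
      (Metric.ball_mem_nhds _ (by linarith : 0 < δ / 4))] with w h1 h2 using ⟨h1, h2⟩
  filter_upwards [eventually_closedBall_subset hnear] with r hr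
  have hrU : Metric.closedBall z r ⊆ U := fun w hw => (hr hw).1
  have hhK : ∀ w ∈ Metric.closedBall z r, h w ∈ K := fun w hw => by
    have h1 := (hr hw).2
    have h2 := dist_triangle_left (h z) q (h w)
    change δ / 2 ≤ dist (h w) q
    change δ ≤ _ at h2
    linarith
  have hunif := (tendstoLocallyUniformlyOn_iff_forall_isCompact hU).1 hl _ hrU
    (isCompact_closedBall z r)
  have huK : ∀ᶠ i in l, ∀ w ∈ Metric.closedBall z r, u i w ∈ K := by
    filter_upwards [Metric.tendstoUniformlyOn_iff.1 hunif (δ / 4) (by linarith)] with i hi w hw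
    have h1 := (hr hw).2
    have h2 := dist_triangle_left (h z) q (h w)
    have h3 := dist_triangle (h w) (u i w) q
    have h4 := hi w hw
    change δ / 2 ≤ dist (u i w) q
    change δ ≤ _ at h2
    linarith
  refine ⟨hrU, fun w hw => hKq _ (hhK w hw), ?_, ?_⟩
  · filter_upwards [huK] with i hi w hw using hKq _ (hi w hw)
  · exact hcK.comp_tendstoUniformlyOn_eventually huK hhK hunif

/-- A locally uniform limit of holomorphic maps to the sphere is holomorphic. -/
theorem HolomorphicOn.of_tendstoLocallyUniformlyOn {ι : Type*} {l : Filter ι} [l.NeBot]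
    {u : ι → ℂ → OnePoint ℂ} {h : ℂ → OnePoint ℂ} {U : Set ℂ} (hU : IsOpen U)
    (hu : ∀ᶠ i in l, HolomorphicOn (u i) U) (hl : TendstoLocallyUniformlyOn u h l U) :
    HolomorphicOn h U := by
  have hc : ContinuousOn h U := hl.continuousOn (hu.mono fun i hi => hi.1).frequently
  have key : ∀ {κ q}, IsChart κ q → ∀ z ∈ U, h z ≠ q → DifferentiableAt ℂ (fun w => κ (h w)) z := by
    intro κ q hκ z hz hq
    obtain ⟨r, ⟨hrU, -, hne, ht⟩, hr⟩ := ((hκ.eventually_tendstoUniformlyOn hU hl hc hz hq).and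
      self_mem_nhdsWithin).exists
    have hd : DifferentiableOn ℂ (fun w => κ (h w)) (Metric.ball z r) := by
      refine (ht.mono Metric.ball_subset_closedBall).tendstoLocallyUniformlyOn.differentiableOn ?_
        Metric.isOpen_ball
      filter_upwards [hu, hne] with i hi hi'
      exact (hi.mono (Metric.ball_subset_closedBall.trans hrU)).differentiableOn_chart hκ
        fun w hw => hi' w (Metric.ball_subset_closedBall hw)
    exact hd.differentiableAt (Metric.ball_mem_nhds z hr)
  exact ⟨hc, fun z hz => ⟨key isChart_coordZero z hz, key isChart_coordInfty z hz⟩⟩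

/-! ### Hurwitz's theorem -/

/-- Zeros of a holomorphic function persist under uniform perturbation. -/
theorem eventually_exists_zero_of_tendstoUniformlyOn {ι : Type*} {l : Filter ι} {F : ι → ℂ → ℂ}
    {F₀ : ℂ → ℂ} {z : ℂ} {r : ℝ} (hr : 0 < r)
    (hd : ∀ᶠ i in l, DiffContOnCl ℂ (F i) (Metric.ball z r))
    (hu : TendstoUniformlyOn F F₀ l (Metric.closedBall z r))
    (hc : ContinuousOn F₀ (Metric.sphere z r)) (hne : ∀ w ∈ Metric.sphere z r, F₀ w ≠ 0)
    (h0 : F₀ z = 0) : ∀ᶠ i in l, ∃ w ∈ Metric.ball z r, F i w = 0 := by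
  obtain ⟨w₀, hw₀, hmin⟩ := (isCompact_sphere z r).exists_isMinOn
    (NormedSpace.sphere_nonempty.2 hr.le) hc.norm
  set m := ‖F₀ w₀‖
  have hm : 0 < m := norm_pos_iff.2 (hne _ hw₀)
  filter_upwards [hd, Metric.tendstoUniformlyOn_iff.1 hu (m / 3) (by linarith)] with i hi hi'
  -- Minimum principle: without zeros, the inverse of `F i` is bounded at the centre by its bound on
  -- the circle, so `‖F i z‖ ≥ 2 * m / 3`, whereas `F i z` is within `m / 3` of `F₀ z = 0`.
  by_contra! hcon
  have hS : ∀ w ∈ Metric.sphere z r, 2 * m / 3 ≤ ‖F i w‖ := fun w hw => by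
    have h1 := hi' w (Metric.sphere_subset_closedBall hw)
    rw [dist_eq_norm] at h1
    have h2 : m ≤ ‖F₀ w‖ := hmin hw
    have h3 := norm_sub_norm_le (F₀ w) (F i w)
    linarith
  have hnz : ∀ w ∈ closure (Metric.ball z r), F i w ≠ 0 := by
    intro w hw
    rw [closure_ball z hr.ne'] at hw
    rcases (Metric.mem_closedBall.1 hw).lt_or_eq with h | h
    · exact hcon w h
    · exact norm_pos_iff.1 (lt_of_lt_of_le (by positivity) (hS w h))
  have hmax := Complex.norm_le_of_forall_mem_frontier_norm_le Metric.isBounded_ball (hi.inv hnz)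
    (C := (2 * m / 3)⁻¹) (fun w hw => by
      rw [frontier_ball z hr.ne'] at hw
      rw [Pi.inv_apply, norm_inv]
      exact inv_anti₀ (by positivity) (hS w hw)) (subset_closure (Metric.mem_ball_self hr))
  have hz := hi' z (Metric.mem_closedBall_self hr.le)
  rw [h0, dist_zero_left] at hz
  rw [Pi.inv_apply, norm_inv, inv_le_inv₀ (norm_pos_iff.2 (hcon z (Metric.mem_ball_self hr)))
    (by positivity)] at hmax
  linarith

/-- Isolated coincidences of two holomorphic maps to the sphere persist under locally uniform
perturbation. -/
theorem eventually_exists_eq_of_tendstoLocallyUniformlyOn {ι : Type*} {l : Filter ι}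
    {u v : ι → ℂ → OnePoint ℂ} {u₀ v₀ : ℂ → OnePoint ℂ} {U : Set ℂ} (hU : IsOpen U)
    (hu : ∀ᶠ i in l, HolomorphicOn (u i) U) (hv : ∀ᶠ i in l, HolomorphicOn (v i) U)
    (hul : TendstoLocallyUniformlyOn u u₀ l U) (hvl : TendstoLocallyUniformlyOn v v₀ l U)
    (hu₀ : ContinuousOn u₀ U) (hv₀ : ContinuousOn v₀ U) {z : ℂ} (hz : z ∈ U) (heq : u₀ z = v₀ z)
    (hne : ∀ᶠ w in 𝓝[≠] z, u₀ w ≠ v₀ w) {r : ℝ} (hr : 0 < r) :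
    ∀ᶠ i in l, ∃ w ∈ Metric.ball z r, w ∈ U ∧ u i w = v i w := by
  obtain ⟨κ, q, hκ, hq⟩ := exists_isChart (u₀ z)
  have hne' : ∀ᶠ s in 𝓝[>] (0 : ℝ), ∀ w ∈ Metric.sphere z s, u₀ w ≠ v₀ w := by
    rw [eventually_nhdsWithin_iff] at hne
    filter_upwards [eventually_closedBall_subset hne, self_mem_nhdsWithin] with s hs hs' w hw
    exact hs (Metric.sphere_subset_closedBall hw) (Metric.ne_of_mem_sphere hw (ne_of_gt hs'))
  obtain ⟨s, ⟨⟨⟨⟨hsU, hu1, hu2, hu3⟩, ⟨-, hv1, hv2, hv3⟩⟩, hs⟩, hsr⟩, hs0⟩ :=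
    ((((hκ.eventually_tendstoUniformlyOn hU hul hu₀ hz hq).and
      (hκ.eventually_tendstoUniformlyOn hU hvl hv₀ hz (heq ▸ hq))).and hne').and
      (Ioc_mem_nhdsGT hr) |>.and self_mem_nhdsWithin).exists
  have hs0 : 0 < s := hs0
  have hcont : ∀ {h : ℂ → OnePoint ℂ}, ContinuousOn h U → (∀ w ∈ Metric.closedBall z s, h w ≠ q) →
      ContinuousOn (fun w => κ (h w)) (Metric.closedBall z s) := fun hh hhq w hw =>
    (hκ.continuousAt _ (hhq w hw)).comp_continuousWithinAt ((hh w (hsU hw)).mono hsU)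
  have hdcc : ∀ {h : ℂ → OnePoint ℂ}, HolomorphicOn h U → (∀ w ∈ Metric.closedBall z s, h w ≠ q) →
      DiffContOnCl ℂ (fun w => κ (h w)) (Metric.ball z s) := fun hh hhq => by
    have := (hh.mono hsU).differentiableOn_chart hκ hhq
    rw [← closure_ball z hs0.ne'] at this
    exact this.diffContOnCl
  have key := eventually_exists_zero_of_tendstoUniformlyOn (l := l)
    (F := fun i w => κ (u i w) - κ (v i w)) (F₀ := fun w => κ (u₀ w) - κ (v₀ w)) hs0
    (by
      filter_upwards [hu, hv, hu2, hv2] with i h1 h2 h3 h4 using (hdcc h1 h3).sub (hdcc h2 h4))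
    (hu3.sub hv3) (((hcont hu₀ hu1).sub (hcont hv₀ hv1)).mono Metric.sphere_subset_closedBall)
    (fun w hw h => hs w hw (hκ.injOn (hu1 w (Metric.sphere_subset_closedBall hw))
      (hv1 w (Metric.sphere_subset_closedBall hw)) (sub_eq_zero.1 h)))
    (by rw [heq, sub_self])
  filter_upwards [key, hu2, hv2] with i hi h3 h4
  obtain ⟨w, hw, hw'⟩ := hi
  have hwc := Metric.ball_subset_closedBall hw
  exact ⟨w, Metric.ball_subset_ball hsr.2 hw, hsU hwc,
    hκ.injOn (h3 w hwc) (h4 w hwc) (sub_eq_zero.1 hw')⟩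

theorem tendstoLocallyUniformlyOn_const {ι : Type*} {l : Filter ι} {p : ι → OnePoint ℂ}
    {p₀ : OnePoint ℂ} (hp : Tendsto p l (𝓝 p₀)) (U : Set ℂ) :
    TendstoLocallyUniformlyOn (fun i _ => p i) (fun _ => p₀) l U :=
  (hp.tendstoUniformlyOn_const U).tendstoLocallyUniformlyOn

theorem eventually_ne_of_injOn {h : ℂ → OnePoint ℂ} {U : Set ℂ} (hU : IsOpen U) (hi : InjOn h U)
    {z : ℂ} (hz : z ∈ U) : ∀ᶠ w in 𝓝[≠] z, h w ≠ h z := by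
  filter_upwards [self_mem_nhdsWithin, nhdsWithin_le_nhds (hU.mem_nhds hz)] with w hw hwU h
  exact hw (hi hwU hz h)

/-- Open mapping as a case of Hurwitz: the map is kept fixed while the constant it is compared with
tends to `h z`, so nearby constants are still attained. -/
theorem HolomorphicOn.isOpen_image {h : ℂ → OnePoint ℂ} {U V : Set ℂ} (hh : HolomorphicOn h U)
    (hi : InjOn h U) (hV : IsOpen V) (hVU : V ⊆ U) : IsOpen (h '' V) := by
  rw [isOpen_iff_mem_nhds]
  rintro _ ⟨z, hz, rfl⟩
  have hhV := hh.mono hVU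
  have := eventually_exists_eq_of_tendstoLocallyUniformlyOn (l := 𝓝 (h z)) (u := fun _ => h)
    (v := fun p _ => p) hV (.of_forall fun _ => hhV) (.of_forall fun p => holomorphicOn_const p V)
    (fun s hs x _ => ⟨univ, univ_mem, .of_forall fun _ _ _ => refl_mem_uniformity hs⟩)
    (tendstoLocallyUniformlyOn_const tendsto_id V) hhV.1 continuousOn_const hz rfl
    (eventually_ne_of_injOn hV (hi.mono hVU) hz) one_pos
  filter_upwards [this] with p hp
  obtain ⟨w, -, hw, rfl⟩ := hp
  exact mem_image_of_mem h hw

/-- Identity principle for maps to the sphere. -/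
theorem HolomorphicOn.const_or_eventually_ne {h : ℂ → OnePoint ℂ} {U : Set ℂ} (hU : IsOpen U)
    (hUc : IsPreconnected U) (hh : HolomorphicOn h U) (p : OnePoint ℂ) :
    (∀ z ∈ U, h z = p) ∨ ∀ z ∈ U, ∀ᶠ w in 𝓝[≠] z, h w ≠ p := by
  have alt : ∀ z ∈ U, (∃ᶠ w in 𝓝[≠] z, h w = p) → ∀ᶠ w in 𝓝 z, h w = p := by
    intro z hz hf
    have hcz := hh.1.continuousAt (hU.mem_nhds hz)
    have hzp : h z = p := by
      by_contra hne
      exact hf ((hcz.eventually_ne hne).filter_mono nhdsWithin_le_nhds)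
    obtain ⟨κ, q, hκ, hq⟩ := exists_isChart (h z)
    have hev : ∀ᶠ w in 𝓝 z, w ∈ U ∧ h w ≠ q := (hU.eventually_mem hz).and (hcz.eventually_ne hq)
    have han : AnalyticAt ℂ (fun w => κ (h w)) z := by
      rw [Complex.analyticAt_iff_eventually_differentiableAt]
      filter_upwards [hev] with w hw using hκ.differentiableAt hh hw.1 hw.2
    rcases han.eventually_eq_or_eventually_ne (analyticAt_const (v := κ p)) with h1 | h1
    · filter_upwards [h1, hev] with w hw hw'
      exact hκ.injOn hw'.2 (hzp ▸ hq) hw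
    · exact absurd (h1.mono fun w hw (h' : h w = p) => hw (congrArg κ h')) hf
  by_cases hcon : ∃ z ∈ U, ∃ᶠ w in 𝓝[≠] z, h w = p
  · left
    obtain ⟨z, hz, hf⟩ := hcon
    -- The set of points near which `h` is locally `p` is open, and by `alt` it is relatively closed
    -- in `U`.
    have hsub := hUc.subset_of_closure_inter_subset (u := {z | ∀ᶠ w in 𝓝 z, h w = p})
      isOpen_setOfPred_eventually_nhds ⟨z, hz, alt z hz hf⟩ (by
        rintro x ⟨hx, hxU⟩
        by_cases hx' : x ∈ {z | ∀ᶠ w in 𝓝 z, h w = p}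
        · exact hx'
        · refine alt x hxU ?_
          rw [mem_closure_iff_frequently] at hx
          rw [frequently_nhdsWithin_iff]
          refine hx.mono fun y hy => ⟨hy.self_of_nhds, ?_⟩
          rintro rfl
          exact hx' hy)
    exact fun z hz => (hsub hz).self_of_nhds
  · right
    push Not at hcon
    exact fun z hz => hcon z hz

/-- **Hurwitz**: a locally uniform limit of injective holomorphic maps is injective or constant. -/
theorem injOn_or_const_of_tendstoLocallyUniformlyOn {ι : Type*} {l : Filter ι} [l.NeBot]
    {u : ι → ℂ → OnePoint ℂ} {h : ℂ → OnePoint ℂ} {U : Set ℂ} (hU : IsOpen U)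
    (hUc : IsPreconnected U) (hu : ∀ᶠ i in l, HolomorphicOn (u i) U)
    (hi : ∀ᶠ i in l, InjOn (u i) U) (hl : TendstoLocallyUniformlyOn u h l U) :
    InjOn h U ∨ ∃ p, ∀ z ∈ U, h z = p := by
  have hh := HolomorphicOn.of_tendstoLocallyUniformlyOn hU hu hl
  by_cases hcon : ∃ p, ∀ z ∈ U, h z = p
  · exact Or.inr hcon
  left
  intro z hz w hw hzw
  by_contra hne
  have hiso := (hh.const_or_eventually_ne hU hUc (h w)).resolve_left fun h' => hcon ⟨_, h'⟩
  -- Compare `u i` with the moving constant `u i w`. The radius `dist z w` keeps the coincidence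
  -- point different from `w`, which contradicts injectivity of `u i`.
  have hev := eventually_exists_eq_of_tendstoLocallyUniformlyOn hU hu
    (.of_forall fun i => holomorphicOn_const (u i w) U) hl
    (tendstoLocallyUniformlyOn_const (hl.tendsto_at hw) U) hh.1 continuousOn_const hz hzw
    (hiso z hz) (dist_pos.2 hne)
  obtain ⟨i, ⟨x, hx, hxU, hxw⟩, hinj⟩ := (hev.and hi).exists
  rw [hinj hxU hw hxw, Metric.mem_ball, dist_comm] at hx
  exact lt_irrefl _ hx

/-! ### Homogeneous coordinates and the chordal metric -/

/-- Homogeneous coordinates of a point of the sphere. -/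
noncomputable def lift (p : OnePoint ℂ) : ℂ × ℂ := p.elim (1, 0) fun z => (z, 1)

@[simp] theorem lift_coe (z : ℂ) : lift (z : OnePoint ℂ) = (z, 1) := rfl
@[simp] theorem lift_infty : lift OnePoint.infty = (1, 0) := rfl

/-- The determinant of the homogeneous coordinates of two points. -/
noncomputable def wedge (p q : OnePoint ℂ) : ℂ := (lift p).1 * (lift q).2 - (lift p).2 * (lift q).1

/-- The Hermitian norm of the homogeneous coordinates. -/
noncomputable def liftNorm (p : OnePoint ℂ) : ℝ := √(‖(lift p).1‖ ^ 2 + ‖(lift p).2‖ ^ 2)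

theorem liftNorm_pos (p : OnePoint ℂ) : 0 < liftNorm p := by
  apply Real.sqrt_pos.2
  induction p using OnePoint.rec with
  | infty => simp
  | coe z => simp; positivity

theorem liftNorm_sq (p : OnePoint ℂ) :
    liftNorm p ^ 2 = ‖(lift p).1‖ ^ 2 + ‖(lift p).2‖ ^ 2 :=
  Real.sq_sqrt (by positivity)

theorem dist_sq_eq (p q : OnePoint ℂ) :
    dist p q ^ 2 = ‖(stereo p).fst - (stereo q).fst‖ ^ 2 + ((stereo p).snd - (stereo q).snd) ^ 2 := by
  have h : dist p q = dist (stereo p) (stereo q) := rfl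
  rw [h, WithLp.prod_dist_eq_of_L2, Real.sq_sqrt (by positivity), dist_eq_norm, Real.dist_eq, sq_abs]

theorem dist_coe_infty_sq (z : ℂ) :
    dist (z : OnePoint ℂ) OnePoint.infty ^ 2 = 4 / (1 + ‖z‖ ^ 2) := by
  rw [dist_sq_eq]
  have h1 : stereo (z : OnePoint ℂ) = WithLp.toLp 2
    ((2 / (1 + ‖z‖ ^ 2) : ℝ) • z, 1 - 2 / (1 + ‖z‖ ^ 2)) := rfl
  have h2 : stereo OnePoint.infty = WithLp.toLp 2 (0, 1) := rfl
  have hp : (1 + ‖z‖ ^ 2 : ℝ) ≠ 0 := by positivity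
  simp only [h1, h2, WithLp.toLp_fst, WithLp.toLp_snd, sub_zero, norm_smul]
  rw [mul_pow, Real.norm_eq_abs, sq_abs]
  field_simp
  ring

theorem dist_coe_coe_sq (z w : ℂ) :
    dist (z : OnePoint ℂ) (w : OnePoint ℂ) ^ 2 =
      4 * ‖z - w‖ ^ 2 / ((1 + ‖z‖ ^ 2) * (1 + ‖w‖ ^ 2)) := by
  rw [dist_sq_eq]
  have h1 : ∀ z : ℂ, stereo (z : OnePoint ℂ) = WithLp.toLp 2
    ((2 / (1 + ‖z‖ ^ 2) : ℝ) • z, 1 - 2 / (1 + ‖z‖ ^ 2)) := fun _ => rfl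
  have hp : ∀ z : ℂ, (1 + ‖z‖ ^ 2 : ℝ) ≠ 0 := fun z => by positivity
  have hz := hp z
  have hw := hp w
  simp only [h1, WithLp.toLp_fst, WithLp.toLp_snd]
  simp only [Complex.sq_norm, Complex.normSq_apply, Complex.sub_re, Complex.sub_im,
    Complex.smul_re, Complex.smul_im, smul_eq_mul] at hz hw ⊢
  field_simp
  ring

/-- The chordal metric in homogeneous coordinates. -/
theorem dist_eq_wedge (p q : OnePoint ℂ) :
    dist p q = 2 * ‖wedge p q‖ / (liftNorm p * liftNorm q) := by
  have hp := liftNorm_pos p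
  have hq := liftNorm_pos q
  rw [← sq_eq_sq₀ dist_nonneg (by positivity), div_pow, mul_pow, mul_pow, liftNorm_sq, liftNorm_sq]
  induction p using OnePoint.rec with
  | infty =>
    induction q using OnePoint.rec with
    | infty => simp [wedge]
    | coe w =>
      rw [dist_comm, dist_coe_infty_sq]
      simp [wedge, add_comm]
      norm_num
  | coe z =>
    induction q using OnePoint.rec with
    | infty =>
      rw [dist_coe_infty_sq]
      simp [wedge, add_comm]
      norm_num
    | coe w =>
      rw [dist_coe_coe_sq]
      simp [wedge, add_comm]
      norm_num

theorem wedge_ne_zero {p q : OnePoint ℂ} : wedge p q ≠ 0 ↔ p ≠ q := by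
  rw [← dist_pos (x := p), dist_eq_wedge, ← norm_pos_iff]
  have hp := liftNorm_pos p
  have hq := liftNorm_pos q
  constructor
  · intro h; positivity
  · intro h
    by_contra h'
    have : ‖wedge p q‖ = 0 := le_antisymm (not_lt.1 h') (norm_nonneg _)
    simp [this] at h

theorem dist_le_two (p q : OnePoint ℂ) : dist p q ≤ 2 := by
  have hp := liftNorm_pos p
  have hq := liftNorm_pos q
  rw [dist_eq_wedge, div_le_iff₀ (by positivity)]
  refine mul_le_mul_of_nonneg_left ?_ two_pos.le
  rw [← sq_le_sq₀ (norm_nonneg _) (by positivity), mul_pow, liftNorm_sq, liftNorm_sq]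
  have h := norm_sub_le ((lift p).1 * (lift q).2) ((lift p).2 * (lift q).1)
  rw [norm_mul, norm_mul] at h
  refine (pow_le_pow_left₀ (norm_nonneg _) h 2).trans ?_
  nlinarith [sq_nonneg (‖(lift p).1‖ * ‖(lift q).1‖ - ‖(lift p).2‖ * ‖(lift q).2‖)]

/-- The Plücker relation, which makes differences of Möbius coordinates factor. -/
theorem wedge_plucker (p q a b : OnePoint ℂ) :
    wedge p a * wedge q b - wedge p b * wedge q a = wedge p q * wedge a b := by
  simp only [wedge]
  ring

/-- The Möbius coordinate with zero `a` and pole `b`. -/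
noncomputable def moebius (a b p : OnePoint ℂ) : ℂ := wedge p a / wedge p b

theorem moebius_ne_zero {a b p : OnePoint ℂ} (ha : p ≠ a) (hb : p ≠ b) : moebius a b p ≠ 0 :=
  div_ne_zero (wedge_ne_zero.2 ha) (wedge_ne_zero.2 hb)

theorem moebius_sub {a b p q : OnePoint ℂ} (hp : p ≠ b) (hq : q ≠ b) :
    moebius a b p - moebius a b q = wedge p q * wedge a b / (wedge p b * wedge q b) := by
  rw [← wedge_plucker, moebius, moebius, div_sub_div _ _ (wedge_ne_zero.2 hp) (wedge_ne_zero.2 hq)]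

theorem moebius_injOn {a b : OnePoint ℂ} (hab : a ≠ b) : InjOn (moebius a b) {b}ᶜ := by
  intro p hp q hq h
  by_contra hne
  refine absurd (sub_eq_zero.2 h) ?_
  rw [moebius_sub hp hq]
  exact div_ne_zero (mul_ne_zero (wedge_ne_zero.2 hne) (wedge_ne_zero.2 hab))
    (mul_ne_zero (wedge_ne_zero.2 hp) (wedge_ne_zero.2 hq))

/-- In homogeneous coordinates this is an exact identity with the factor `dist p b * dist q a` on
the right, and the sphere has diameter at most `2`. It turns a relative estimate in the Möbius
coordinate into a chordal one. -/
theorem dist_mul_dist_le_moebius {a b p q : OnePoint ℂ} (hp : p ≠ b) (hq : q ≠ b) :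
    dist p q * dist a b * ‖moebius a b q‖ ≤ 4 * ‖moebius a b p - moebius a b q‖ := by
  have h1 : ‖moebius a b p - moebius a b q‖ * (dist p b * dist q a) =
      dist p q * dist a b * ‖moebius a b q‖ := by
    have hpn := (liftNorm_pos p).ne'
    have hqn := (liftNorm_pos q).ne'
    have han := (liftNorm_pos a).ne'
    have hbn := (liftNorm_pos b).ne'
    have e1 := norm_ne_zero_iff.2 (wedge_ne_zero.2 hp)
    have e2 := norm_ne_zero_iff.2 (wedge_ne_zero.2 hq)
    rw [moebius_sub hp hq, moebius]
    simp only [dist_eq_wedge, norm_mul, norm_div]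
    field_simp
  have h2 : dist p b * dist q a ≤ 2 * 2 :=
    mul_le_mul (dist_le_two _ _) (dist_le_two _ _) dist_nonneg two_pos.le
  rw [← h1]
  nlinarith [norm_nonneg (moebius a b p - moebius a b q)]

theorem HolomorphicOn.differentiableOn_moebius {h : ℂ → OnePoint ℂ} {U : Set ℂ} (hU : IsOpen U)
    (hh : HolomorphicOn h U) {a b : OnePoint ℂ} (hb : ∀ z ∈ U, h z ≠ b) :
    DifferentiableOn ℂ (fun z => moebius a b (h z)) U := by
  intro z hz
  apply DifferentiableAt.differentiableWithinAt
  have hcz := hh.1.continuousAt (hU.mem_nhds hz)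
  have hw := wedge_ne_zero.2 (hb z hz)
  by_cases hzi : h z = OnePoint.infty
  · have hz0 : h z ≠ ((0 : ℂ) : OnePoint ℂ) := by rw [hzi]; exact OnePoint.infty_ne_coe _
    have hd := (hh.2 z hz).2 hz0
    have hev : (fun w => moebius a b (h w)) =ᶠ[𝓝 z] fun w =>
        ((lift a).2 - coordInfty (h w) * (lift a).1) /
          ((lift b).2 - coordInfty (h w) * (lift b).1) := by
      filter_upwards [hcz.eventually_ne hz0] with w hw
      generalize h w = p at hw
      induction p using OnePoint.rec with
      | infty => simp [moebius, wedge]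
      | coe x =>
        have hx : x ≠ 0 := fun h => hw (by rw [h])
        have e : ∀ c : OnePoint ℂ, wedge x c = x * ((lift c).2 - x⁻¹ * (lift c).1) := fun c => by
          simp only [wedge, lift_coe]
          field_simp
        rw [moebius, e, e, mul_div_mul_left _ _ hx, coordInfty_coe]
    refine DifferentiableAt.congr_of_eventuallyEq ?_ hev
    refine ((hd.mul_const _).const_sub _).fun_div ((hd.mul_const _).const_sub _) ?_
    simpa [hzi, wedge] using hw
  · have hd := (hh.2 z hz).1 hzi
    have hev : (fun w => moebius a b (h w)) =ᶠ[𝓝 z] fun w =>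
        (coordZero (h w) * (lift a).2 - (lift a).1) /
          (coordZero (h w) * (lift b).2 - (lift b).1) := by
      filter_upwards [hcz.eventually_ne hzi] with w hw
      generalize h w = p at hw
      induction p using OnePoint.rec with
      | infty => exact absurd rfl hw
      | coe x => simp [moebius, wedge]
    refine DifferentiableAt.congr_of_eventuallyEq ?_ hev
    refine ((hd.mul_const _).sub_const _).fun_div ((hd.mul_const _).sub_const _) ?_
    generalize h z = p at hw hzi
    induction p using OnePoint.rec with
    | infty => exact absurd rfl hzi
    | coe x => simpa [wedge] using hw

/-! ### A weak form of Bloch's theorem and its consequence for univalent functions -/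

/-- **Bloch's theorem** with a non-optimal constant. -/
theorem exists_ball_subset_image_of_differentiableOn {G : ℂ → ℂ} {z : ℂ} {r R : ℝ} (hr : 0 < r)
    (hrR : r < R) (hd : DifferentiableOn ℂ G (Metric.ball z R)) :
    ∃ c, Metric.ball c (r * ‖deriv G z‖ / 48) ⊆ G '' Metric.ball z R := by
  by_cases h0 : deriv G z = 0
  · exact ⟨0, by simp [h0]⟩
  have hsub : Metric.closedBall z r ⊆ Metric.ball z R := Metric.closedBall_subset_ball hrR
  have hd' : DifferentiableOn ℂ (deriv G) (Metric.ball z R) := hd.deriv Metric.isOpen_ball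
  -- Landau's device: maximize the derivative weighted by the distance to the boundary. Within half
  -- of that distance from the maximizer `a`, the derivative is at most twice its size at `a`.
  obtain ⟨a, ha, hmax⟩ := (isCompact_closedBall z r).exists_isMaxOn
    (Metric.nonempty_closedBall.2 hr.le) (f := fun w => (r - dist w z) * ‖deriv G w‖)
    ((continuousOn_const.sub (continuous_id.dist continuous_const).continuousOn).mul
      (hd'.continuousOn.mono hsub).norm)
  have hmax : ∀ w ∈ Metric.closedBall z r,
    (r - dist w z) * ‖deriv G w‖ ≤ (r - dist a z) * ‖deriv G a‖ := hmax
  have hz := hmax z (Metric.mem_closedBall_self hr.le)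
  rw [dist_self, sub_zero] at hz
  have hpos : 0 < (r - dist a z) * ‖deriv G a‖ :=
    (mul_pos hr (norm_pos_iff.2 h0)).trans_le hz
  set m := ‖deriv G a‖
  have hm : 0 < m := by
    rcases (norm_nonneg (deriv G a)).eq_or_lt with h | h
    · change (0 : ℝ) = m at h
      rw [← h, mul_zero] at hpos
      exact absurd hpos (lt_irrefl _)
    · exact h
  have haz : 0 < r - dist a z := (pos_iff_pos_of_mul_pos hpos).2 hm
  set ρ := (r - dist a z) / 2 with hρ
  have hρ0 : 0 < ρ := by positivity
  have hball : Metric.ball a ρ ⊆ Metric.closedBall z r := fun w hw => by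
    have h1 := dist_triangle w a z
    have h2 := Metric.mem_ball.1 hw
    exact Metric.mem_closedBall.2 (by linarith)
  have hbound : ∀ w ∈ Metric.ball a ρ, ‖deriv G w‖ ≤ 2 * m := fun w hw => by
    have h1 := hmax w (hball hw)
    have h2 := dist_triangle w a z
    have h3 := Metric.mem_ball.1 hw
    have h4 : ρ * ‖deriv G w‖ ≤ (r - dist w z) * ‖deriv G w‖ :=
      mul_le_mul_of_nonneg_right (by linarith) (norm_nonneg _)
    have h5 : ρ * ‖deriv G w‖ ≤ ρ * (2 * m) := by
      have : (r - dist a z) * m = ρ * (2 * m) := by rw [hρ]; ring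
      linarith
    exact le_of_mul_le_mul_left h5 hρ0
  have hschwarz : ∀ w ∈ Metric.ball a ρ, dist (deriv G w) (deriv G a) ≤ 3 * m / ρ * dist w a :=
    fun w hw => Complex.dist_le_div_mul_dist_of_mapsTo_ball (hd'.mono (hball.trans hsub))
      (fun x hx => by
        rw [Metric.mem_closedBall, dist_eq_norm]
        have h1 := norm_sub_le (deriv G x) (deriv G a)
        have h2 := hbound x hx
        change _ ≤ _ + m at h1
        linarith) hw
  -- At distance `ρ / 6` the Schwarz bound `3 * m / ρ * dist w a` equals `m / 2`, so `G` is close to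
  -- its linear part at `a`.
  set s := ρ / 6 with hs
  have hs0 : 0 < s := by positivity
  have hsρ : Metric.closedBall a s ⊆ Metric.ball a ρ := Metric.closedBall_subset_ball (by linarith)
  have hlin : ∀ w ∈ Metric.closedBall a s,
      ‖(G w - deriv G a * w) - (G a - deriv G a * a)‖ ≤ m / 2 * ‖w - a‖ := by
    intro w hw
    refine (convex_closedBall a s).norm_image_sub_le_of_norm_hasDerivWithin_le
      (f := fun w => G w - deriv G a * w) (f' := fun w => deriv G w - deriv G a)
      (fun x hx => ?_) (fun x hx => ?_) (Metric.mem_closedBall_self hs0.le) hw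
    · have hx' := hsub (hball (hsρ hx))
      have h1 := (hd.differentiableAt (Metric.isOpen_ball.mem_nhds hx')).hasDerivAt
      have h2 := (hasDerivAt_id x).const_mul (deriv G a)
      simpa using! (h1.sub h2).hasDerivWithinAt
    · have h1 := hschwarz x (hsρ hx)
      rw [← dist_eq_norm]
      refine h1.trans ?_
      have h2 := Metric.mem_closedBall.1 hx
      calc 3 * m / ρ * dist x a ≤ 3 * m / ρ * (ρ / 6) := by gcongr
        _ = m / 2 := by field_simp; ring
  refine ⟨G a, ?_⟩
  -- On the circle of radius `s`, `G` stays at distance at least `m * s - m * s / 2` from `G a`. The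
  -- covering lemma halves this once more, which gives the constant 48 = 2 · 6 · 4.
  have hsurj := DiffContOnCl.ball_subset_image_closedBall (f := G) (z₀ := a) (r := s)
    (ε := m * s / 2) (by
      have := hd.mono ((hsρ.trans hball).trans hsub)
      rw [← closure_ball a hs0.ne'] at this
      exact this.diffContOnCl) hs0 (by
      intro w hw
      have h1 := hlin w (Metric.sphere_subset_closedBall hw)
      have h2 : ‖w - a‖ = s := by rw [← dist_eq_norm]; exact hw
      have h3 : ‖deriv G a * (w - a)‖ = m * s := by rw [norm_mul, h2]
      have h4 : G w - G a =
        deriv G a * (w - a) + ((G w - deriv G a * w) - (G a - deriv G a * a)) := by ring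
      rw [h4]
      have h5 := norm_sub_le_norm_add (deriv G a * (w - a))
        ((G w - deriv G a * w) - (G a - deriv G a * a))
      rw [h2] at h1
      rw [h3] at h5
      linarith) (by
      have h1 := (hd.differentiableAt (Metric.isOpen_ball.mem_nhds (hsub ha))).hasDerivAt
      exact (h1.eventually_ne (norm_pos_iff.1 hm)).frequently.filter_mono nhdsWithin_le_nhds)
  refine (Metric.ball_subset_ball ?_).trans
    (hsurj.trans (image_mono ((hsρ.trans hball).trans hsub)))
  have : m * s / 2 / 2 = (r - dist a z) * m / 48 := by rw [hs, hρ]; ring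
  rw [this]
  gcongr

/-- `G` is the primitive of the logarithmic derivative vanishing at the centre; `F * exp (-G)` has
derivative zero. -/
theorem exists_eq_mul_exp_of_ne_zero {F : ℂ → ℂ} {z : ℂ} {R : ℝ}
    (hd : DifferentiableOn ℂ F (Metric.ball z R)) (h0 : ∀ w ∈ Metric.ball z R, F w ≠ 0) :
    ∃ G : ℂ → ℂ, (∀ w ∈ Metric.ball z R, HasDerivAt G (deriv F w / F w) w) ∧
      ∀ w ∈ Metric.ball z R, F w = F z * Complex.exp (G w) := by
  obtain ⟨G, hG0, hG⟩ := ((hd.deriv Metric.isOpen_ball).fun_div hd h0).isExactOn_ball.with_val_at z 0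
  refine ⟨G, hG, fun w hw => ?_⟩
  have hFd : ∀ x ∈ Metric.ball z R, HasDerivAt F (deriv F x) x := fun x hx =>
    (hd.differentiableAt (Metric.isOpen_ball.mem_nhds hx)).hasDerivAt
  have hzero : ∀ x ∈ Metric.ball z R,
      HasDerivWithinAt (fun x => F x * Complex.exp (-G x)) 0 (Metric.ball z R) x := by
    intro x hx
    have h := ((hFd x hx).mul (hG x hx).neg.cexp).hasDerivWithinAt (s := Metric.ball z R)
    have e : deriv F x * Complex.exp ((-G) x) +
        F x * (Complex.exp ((-G) x) * -(deriv F x / F x)) = 0 := by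
      have := h0 x hx
      field_simp
      ring
    rw [e] at h
    exact h
  have hz : z ∈ Metric.ball z R :=
    Metric.mem_ball_self (dist_nonneg.trans_lt (Metric.mem_ball.1 hw))
  have hc := (convex_ball z R).norm_image_sub_le_of_norm_hasDerivWithin_le hzero (C := 0)
    (fun x _ => by simp) hz hw
  rw [zero_mul, norm_le_zero_iff, sub_eq_zero, hG0, neg_zero, Complex.exp_zero, mul_one] at hc
  rw [← hc, mul_assoc, ← Complex.exp_add, neg_add_cancel, Complex.exp_zero, mul_one]

/-- The logarithmic derivative of a nonvanishing univalent function is bounded by a multiple of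
the inverse distance to the boundary. -/
theorem norm_logDeriv_le_of_injOn {F : ℂ → ℂ} {z : ℂ} {R : ℝ} (hR : 0 < R)
    (hd : DifferentiableOn ℂ F (Metric.ball z R)) (h0 : ∀ w ∈ Metric.ball z R, F w ≠ 0)
    (hi : InjOn F (Metric.ball z R)) : ‖deriv F z / F z‖ ≤ 400 / R := by
  obtain ⟨G, hG, hexp⟩ := exists_eq_mul_exp_of_ne_zero hd h0
  have hz := Metric.mem_ball_self (x := z) hR
  obtain ⟨c, hc⟩ := exists_ball_subset_image_of_differentiableOn (half_pos hR) (half_lt_self hR)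
    (fun w hw => (hG w hw).differentiableAt.differentiableWithinAt)
  rw [(hG z hz).deriv] at hc
  by_contra! hlt
  -- The constant 400 is chosen so that 400 / 96 exceeds 4 and hence π. The image of `G` then
  -- contains `c ± πi`, two points with the same exponential.
  have hbig : Real.pi < R / 2 * ‖deriv F z / F z‖ / 48 := by
    rw [div_lt_iff₀ hR] at hlt
    have := Real.pi_lt_four
    linarith
  have hmem : ∀ ε : ℂ, ‖ε‖ = Real.pi → c + ε ∈ G '' Metric.ball z R := fun ε hε => hc (by
    rw [Metric.mem_ball, dist_eq_norm, add_sub_cancel_left, hε]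
    exact hbig)
  obtain ⟨x, hx, hGx⟩ := hmem (Real.pi * Complex.I) (by simp [abs_of_pos Real.pi_pos])
  obtain ⟨y, hy, hGy⟩ := hmem (-(Real.pi * Complex.I)) (by simp [abs_of_pos Real.pi_pos])
  have hxy : x = y := hi hx hy (by
    rw [hexp x hx, hexp y hy, hGx, hGy, Complex.exp_add, Complex.exp_add, Complex.exp_neg,
      Complex.exp_pi_mul_I, inv_neg, inv_one])
  rw [hxy, hGy, add_left_cancel_iff] at hGx
  have := congrArg Complex.im hGx
  simp at this
  linarith [Real.pi_pos]

/-- Integrate the bound on the logarithmic derivative. The radius `R / 800` keeps the increment of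
the logarithm at most `1`, where `‖exp u - 1‖ ≤ 2 * ‖u‖`. -/
theorem norm_sub_le_of_injOn_of_ne_zero {F : ℂ → ℂ} {z : ℂ} {R : ℝ} (hR : 0 < R)
    (hd : DifferentiableOn ℂ F (Metric.ball z (2 * R)))
    (h0 : ∀ w ∈ Metric.ball z (2 * R), F w ≠ 0) (hi : InjOn F (Metric.ball z (2 * R))) {x y : ℂ}
    (hx : x ∈ Metric.ball z (R / 800)) (hy : y ∈ Metric.ball z (R / 800)) :
    ‖F x - F y‖ ≤ 800 / R * ‖x - y‖ * ‖F y‖ := by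
  have hsub : Metric.ball z R ⊆ Metric.ball z (2 * R) := Metric.ball_subset_ball (by linarith)
  obtain ⟨G, hG, hexp⟩ := exists_eq_mul_exp_of_ne_zero (hd.mono hsub) fun w hw => h0 w (hsub hw)
  have hx' : x ∈ Metric.ball z R := Metric.ball_subset_ball (by linarith) hx
  have hy' : y ∈ Metric.ball z R := Metric.ball_subset_ball (by linarith) hy
  have hlip : ‖G x - G y‖ ≤ 400 / R * ‖x - y‖ := by
    refine (convex_ball z R).norm_image_sub_le_of_norm_hasDerivWithin_le
      (fun w hw => (hG w hw).hasDerivWithinAt) (fun w hw => ?_) hy' hx'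
    have hw2 : Metric.ball w R ⊆ Metric.ball z (2 * R) := Metric.ball_subset_ball' (by
      have := Metric.mem_ball.1 hw
      linarith)
    exact norm_logDeriv_le_of_injOn hR (hd.mono hw2) (fun v hv => h0 v (hw2 hv)) (hi.mono hw2)
  have hxy : ‖x - y‖ ≤ R / 400 := by
    rw [← dist_eq_norm]
    have h1 := dist_triangle_right x y z
    have h2 := Metric.mem_ball.1 hx
    have h3 := Metric.mem_ball.1 hy
    linarith
  have hle1 : ‖G x - G y‖ ≤ 1 := hlip.trans (by
    calc 400 / R * ‖x - y‖ ≤ 400 / R * (R / 400) := by gcongr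
      _ = 1 := by field_simp)
  have he : F x - F y = (Complex.exp (G x - G y) - 1) * F y := by
    rw [hexp x hx', hexp y hy', Complex.exp_sub]
    field_simp [Complex.exp_ne_zero]
  rw [he, norm_mul]
  refine mul_le_mul_of_nonneg_right ?_ (norm_nonneg _)
  refine (Complex.norm_exp_sub_one_le hle1).trans ?_
  calc 2 * ‖G x - G y‖ ≤ 2 * (400 / R * ‖x - y‖) := by gcongr
    _ = 800 / R * ‖x - y‖ := by ring

/-- Univalent maps to the sphere omitting two points are locally Lipschitz, with a constant that
depends only on the distance of the omitted points and the distance to the boundary. -/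
theorem HolomorphicOn.dist_le_of_injOn_of_omits {h : ℂ → OnePoint ℂ} {z : ℂ} {R δ : ℝ} (hR : 0 < R)
    (hh : HolomorphicOn h (Metric.ball z (2 * R))) (hi : InjOn h (Metric.ball z (2 * R)))
    {a b : OnePoint ℂ} (hδ : 0 < δ) (hab : δ ≤ dist a b)
    (ha : ∀ w ∈ Metric.ball z (2 * R), h w ≠ a) (hb : ∀ w ∈ Metric.ball z (2 * R), h w ≠ b) {x y : ℂ}
    (hx : x ∈ Metric.ball z (R / 800)) (hy : y ∈ Metric.ball z (R / 800)) :
    dist (h x) (h y) ≤ 3200 / (δ * R) * ‖x - y‖ := by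
  have hsub : Metric.ball z (R / 800) ⊆ Metric.ball z (2 * R) :=
    Metric.ball_subset_ball (by linarith)
  have hne : a ≠ b := dist_pos.1 (hδ.trans_le hab)
  have h1 := norm_sub_le_of_injOn_of_ne_zero (F := fun z => moebius a b (h z)) hR
    (hh.differentiableOn_moebius Metric.isOpen_ball hb)
    (fun w hw => moebius_ne_zero (ha w hw) (hb w hw))
    (fun v hv w hw hvw => hi hv hw (moebius_injOn hne (hb v hv) (hb w hw) hvw)) hx hy
  have h2 := dist_mul_dist_le_moebius (a := a) (hb x (hsub hx)) (hb y (hsub hy))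
  have h3 : 0 < ‖moebius a b (h y)‖ :=
    norm_pos_iff.2 (moebius_ne_zero (ha y (hsub hy)) (hb y (hsub hy)))
  have h4 : dist (h x) (h y) * dist a b ≤ 3200 / R * ‖x - y‖ := by
    refine le_of_mul_le_mul_right (h2.trans ?_) h3
    calc _ ≤ 4 * (800 / R * ‖x - y‖ * ‖moebius a b (h y)‖) := by gcongr
      _ = _ := by ring
  have h5 : dist (h x) (h y) * δ ≤ 3200 / R * ‖x - y‖ :=
    (mul_le_mul_of_nonneg_left hab dist_nonneg).trans h4
  rw [← le_div_iff₀ hδ] at h5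
  refine h5.trans_eq ?_
  field_simp

/-! ### Rational maps -/

theorem ratio_of_ne {a b : ℂ} (hb : b ≠ 0) : ratio a b = ((a / b : ℂ) : OnePoint ℂ) := if_neg hb

@[simp] theorem ratio_zero_right (a : ℂ) : ratio a 0 = OnePoint.infty := if_pos rfl

theorem ratio_eq_infty_iff {a b : ℂ} : ratio a b = OnePoint.infty ↔ b = 0 := by
  by_cases hb : b = 0
  · simp [hb]
  · simp [ratio_of_ne hb, hb]

theorem ratio_eq_coe_iff {a b c : ℂ} (h : b = 0 → a ≠ 0) : ratio a b = c ↔ a = c * b := by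
  by_cases hb : b = 0
  · simp [hb, h hb]
  · rw [ratio_of_ne hb, OnePoint.coe_eq_coe, div_eq_iff hb]

theorem ratio_mul_left {c : ℂ} (hc : c ≠ 0) (a b : ℂ) : ratio (c * a) (c * b) = ratio a b := by
  by_cases hb : b = 0
  · simp [hb]
  · rw [ratio_of_ne hb, ratio_of_ne (mul_ne_zero hc hb), mul_div_mul_left _ _ hc]

theorem coordZero_ratio (a b : ℂ) : coordZero (ratio a b) = a / b := by
  by_cases hb : b = 0
  · simp [hb]
  · rw [ratio_of_ne hb, coordZero_coe]

theorem coordInfty_ratio (a b : ℂ) : coordInfty (ratio a b) = b / a := by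
  by_cases hb : b = 0
  · simp [hb]
  · rw [ratio_of_ne hb, coordInfty_coe, inv_div]

/-- The two standard charts of the ratio are `P / Q` and `Q / P`. Without a common zero, one of the
denominators is nonzero at each point. -/
theorem holomorphicOn_ratio {P Q : ℂ → ℂ} (hP : Differentiable ℂ P) (hQ : Differentiable ℂ Q)
    (h : ∀ z, Q z = 0 → P z ≠ 0) : HolomorphicOn (fun w => ratio (P w) (Q w)) univ := by
  constructor
  · rw [continuousOn_univ, continuous_iff_continuousAt]
    intro z
    by_cases hz : Q z = 0
    · rw [ContinuousAt, hz, ratio_zero_right, OnePoint.hasBasis_nhds_infty.tendsto_right_iff]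
      rintro s ⟨-, hs⟩
      obtain ⟨M, hM⟩ := hs.isBounded.exists_norm_le
      have h1 : ∀ᶠ w in 𝓝 z, ‖Q w‖ * M < ‖P w‖ := by
        refine ((hQ.continuous.norm.mul_const M).continuousAt).eventually_lt
          hP.continuous.norm.continuousAt ?_
        simpa [hz] using h z hz
      filter_upwards [h1] with w hw
      by_cases hw0 : Q w = 0
      · right
        rw [hw0, ratio_zero_right]
        rfl
      · left
        rw [ratio_of_ne hw0]
        refine mem_image_of_mem _ fun hws => ?_
        have h2 := hM _ hws
        rw [norm_div, div_le_iff₀ (norm_pos_iff.2 hw0), mul_comm] at h2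
        linarith
    · have h1 : (fun w => ratio (P w) (Q w)) =ᶠ[𝓝 z] fun w => ((P w / Q w : ℂ) : OnePoint ℂ) := by
        filter_upwards [hQ.continuous.continuousAt.eventually_ne hz] with w hw using ratio_of_ne hw
      refine ContinuousAt.congr ?_ h1.symm
      exact OnePoint.continuous_coe.continuousAt.comp
        (hP.continuous.continuousAt.div hQ.continuous.continuousAt hz)
  · intro z _
    simp only [coordZero_ratio, coordInfty_ratio]
    refine ⟨fun hz => (hP z).fun_div (hQ z) fun h0 => hz ?_,
      fun hz => (hQ z).fun_div (hP z) fun h0 => hz ?_⟩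
    · rw [h0, ratio_zero_right]
    · rw [h0, ratio_of_ne fun h1 => h z h1 h0, zero_div]

theorem eval_ne_zero_of_isCoprime {p q : Polynomial ℂ} (h : IsCoprime p q) {z : ℂ}
    (hq : q.eval z = 0) : p.eval z ≠ 0 := by
  intro hp
  obtain ⟨a, b, hab⟩ := h
  have := congrArg (Polynomial.eval z) hab
  simp [hp, hq] at this

/-- The two homogenized forms have no common zero at `∞`. For `d = 0` both polynomials could vanish.
-/
theorem coeff_ne_zero_of_max_natDegree {d : ℕ} (hd : d ≠ 0) {p q : Polynomial ℂ}
    (h : max p.natDegree q.natDegree = d) (hq : q.coeff d = 0) : p.coeff d ≠ 0 := by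
  have lc : ∀ r : Polynomial ℂ, r.natDegree = d → r.coeff d ≠ 0 := by
    rintro r hr h0
    rw [← hr, Polynomial.coeff_natDegree, Polynomial.leadingCoeff_eq_zero] at h0
    rw [h0, Polynomial.natDegree_zero] at hr
    exact hd hr.symm
  rcases max_choice p.natDegree q.natDegree with h' | h'
  · exact lc p (h' ▸ h)
  · exact absurd hq (lc q (h' ▸ h))

/-- The left side is the form of degree `d` evaluated at `[1 : w]`, which expresses a rational map
near `∞`. -/
theorem sum_coeff_mul_pow_sub {d : ℕ} {p : Polynomial ℂ} (hp : p.natDegree ≤ d) {w : ℂ}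
    (hw : w ≠ 0) :
    ∑ i ∈ Finset.range (d + 1), p.coeff i * w ^ (d - i) = w ^ d * p.eval w⁻¹ := by
  rw [Polynomial.eval_eq_sum_range' (Nat.lt_succ_of_le hp), Finset.mul_sum]
  refine Finset.sum_congr rfl fun i hi => ?_
  have hi' : i ≤ d := Nat.lt_succ_iff.1 (Finset.mem_range.1 hi)
  rw [pow_sub₀ w hw hi', inv_pow]
  ring

theorem sum_coeff_mul_zero_pow_sub (d : ℕ) (p : Polynomial ℂ) :
    ∑ i ∈ Finset.range (d + 1), p.coeff i * (0 : ℂ) ^ (d - i) = p.coeff d := by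
  rw [Finset.sum_range_succ, Finset.sum_eq_zero]
  · simp
  · intro i hi
    have : d - i ≠ 0 := Nat.sub_ne_zero_of_lt (Finset.mem_range.1 hi)
    rw [zero_pow this, mul_zero]

/-- Around every point the sphere has a global holomorphic parametrization with respect to which
all rational maps are holomorphic. -/
theorem exists_parametrization (p : OnePoint ℂ) : ∃ (χ : ℂ → OnePoint ℂ) (z : ℂ), χ z = p ∧
    HolomorphicOn χ univ ∧ Function.Injective χ ∧
    ∀ d f, d ≠ 0 → IsRationalMap d f → HolomorphicOn (fun w => f (χ w)) univ := by
  induction p using OnePoint.rec with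
  | coe z =>
    have h1 : (fun w : ℂ => (w : OnePoint ℂ)) = fun w => ratio w 1 := by
      ext w
      rw [ratio_of_ne one_ne_zero, div_one]
    refine ⟨fun w => w, z, rfl, ?_, OnePoint.coe_injective, ?_⟩
    · rw [h1]
      exact holomorphicOn_ratio differentiable_id (differentiable_const _)
        fun z h => absurd h one_ne_zero
    · rintro d f - ⟨p, q, hpq, -, hf, -⟩
      simp only [hf]
      exact holomorphicOn_ratio p.differentiable q.differentiable
        fun z => eval_ne_zero_of_isCoprime hpq
  | infty =>
    refine ⟨fun w => ratio 1 w, 0, ratio_zero_right 1, ?_, ?_, ?_⟩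
    · exact holomorphicOn_ratio (differentiable_const _) differentiable_id
        fun _ _ => one_ne_zero
    · intro x y hxy
      have := congrArg coordInfty hxy
      simpa [coordInfty_ratio] using this
    · rintro d f hd ⟨p, q, hpq, hmax, hf, hinf⟩
      have hp : p.natDegree ≤ d := hmax ▸ le_max_left _ _
      have hq : q.natDegree ≤ d := hmax ▸ le_max_right _ _
      have h1 : (fun w => f (ratio 1 w)) = fun w =>
          ratio (∑ i ∈ Finset.range (d + 1), p.coeff i * w ^ (d - i))
            (∑ i ∈ Finset.range (d + 1), q.coeff i * w ^ (d - i)) := by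
        ext w
        by_cases hw : w = 0
        · rw [hw, ratio_zero_right, hinf, sum_coeff_mul_zero_pow_sub, sum_coeff_mul_zero_pow_sub]
        · rw [ratio_of_ne hw, hf, one_div, sum_coeff_mul_pow_sub hp hw, sum_coeff_mul_pow_sub hq hw,
            ratio_mul_left (pow_ne_zero _ hw)]
      rw [h1]
      refine holomorphicOn_ratio (by fun_prop) (by fun_prop) fun w => ?_
      by_cases hw : w = 0
      · rw [hw, sum_coeff_mul_zero_pow_sub, sum_coeff_mul_zero_pow_sub]
        exact coeff_ne_zero_of_max_natDegree hd hmax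
      · rw [sum_coeff_mul_pow_sub hp hw, sum_coeff_mul_pow_sub hq hw]
        intro h
        exact mul_ne_zero (pow_ne_zero _ hw) (eval_ne_zero_of_isCoprime hpq
          ((mul_eq_zero.1 h).resolve_left (pow_ne_zero _ hw)))

theorem IsRationalMap.continuous {d : ℕ} {f : OnePoint ℂ → OnePoint ℂ} (hd : d ≠ 0)
    (hf : IsRationalMap d f) : Continuous f := by
  rw [continuous_iff_continuousAt]
  intro p
  obtain ⟨χ, z, rfl, hχ, hinj, hrat⟩ := exists_parametrization p
  -- The parametrization is open, so continuity of `f` can be tested after composing with it.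
  have hopen : 𝓝 (χ z) ≤ map χ (𝓝 z) := by
    intro V hV
    obtain ⟨W, hWV, hW, hzW⟩ := mem_nhds_iff.1 (mem_map.1 hV)
    exact mem_of_superset ((hχ.isOpen_image hinj.injOn hW (subset_univ W)).mem_nhds
      (mem_image_of_mem χ hzW)) (image_subset_iff.2 hWV)
  have h1 : Tendsto (fun w => f (χ w)) (𝓝 z) (𝓝 (f (χ z))) :=
    (hrat d f hd hf).1.continuousAt univ_mem
  exact (tendsto_map'_iff.2 h1).mono_left hopen

theorem finite_of_finite_coe_preimage {s : Set (OnePoint ℂ)}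
    (h : {z : ℂ | (z : OnePoint ℂ) ∈ s}.Finite) : s.Finite := by
  refine ((h.image (fun z : ℂ => (z : OnePoint ℂ))).union (finite_singleton OnePoint.infty)).subset ?_
  intro p hp
  induction p using OnePoint.rec with
  | infty => exact Or.inr rfl
  | coe z => exact Or.inl (mem_image_of_mem _ hp)

theorem natDegree_eq_zero_of_isCoprime_mul {p q r : Polynomial ℂ} (h : IsCoprime p q)
    (hp : p = r * q) : q.natDegree = 0 := by
  have hu : IsUnit q := h.isUnit_of_dvd' ⟨r, by rw [hp, mul_comm]⟩ dvd_rfl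
  exact Polynomial.natDegree_eq_zero_of_isUnit hu

theorem IsRationalMap.finite_fixedPoints {d : ℕ} {f : OnePoint ℂ → OnePoint ℂ} (hd : 2 ≤ d)
    (hf : IsRationalMap d f) : (Function.fixedPoints f).Finite := by
  obtain ⟨p, q, hpq, hmax, hf, -⟩ := hf
  have hne : p - Polynomial.X * q ≠ 0 := by
    intro h
    rw [sub_eq_zero] at h
    have h0 := natDegree_eq_zero_of_isCoprime_mul hpq h
    have h1 : p.natDegree ≤ 1 + 0 := by
      rw [h, ← h0]
      exact Polynomial.natDegree_mul_le.trans (by simp)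
    rw [h0] at hmax
    omega
  refine finite_of_finite_coe_preimage ((Polynomial.finite_setOfPred_isRoot hne).subset ?_)
  intro z hz
  have hz : f z = z := hz
  rw [hf, ratio_eq_coe_iff (eval_ne_zero_of_isCoprime hpq)] at hz
  simp [hz]

theorem IsRationalMap.finite_fiber {d : ℕ} {f : OnePoint ℂ → OnePoint ℂ} (hd : d ≠ 0)
    (hf : IsRationalMap d f) (a : OnePoint ℂ) : {p | f p = a}.Finite := by
  obtain ⟨p, q, hpq, hmax, hf, -⟩ := hf
  apply finite_of_finite_coe_preimage
  induction a using OnePoint.rec with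
  | infty =>
    have hne : q ≠ 0 := by
      rintro rfl
      have := Polynomial.natDegree_eq_zero_of_isUnit (isCoprime_zero_right.1 hpq)
      rw [this, Polynomial.natDegree_zero] at hmax
      exact hd hmax.symm
    refine (Polynomial.finite_setOfPred_isRoot hne).subset fun z hz => ?_
    have hz : f z = OnePoint.infty := hz
    rwa [hf, ratio_eq_infty_iff] at hz
  | coe a =>
    have hne : p - Polynomial.C a * q ≠ 0 := by
      intro h
      rw [sub_eq_zero] at h
      have h0 := natDegree_eq_zero_of_isCoprime_mul hpq h
      have h1 : p.natDegree ≤ 0 + 0 := by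
        rw [h, ← h0]
        exact Polynomial.natDegree_mul_le.trans (by simp)
      rw [h0] at hmax
      omega
    refine (Polynomial.finite_setOfPred_isRoot hne).subset fun z hz => ?_
    have hz : f z = a := hz
    rw [hf, ratio_eq_coe_iff (eval_ne_zero_of_isCoprime hpq)] at hz
    simp [hz]

/-- The cofactor of `X - a` is nonconstant, so it has a root, which must again be `a`: the root is
multiple. -/
theorem eval_derivative_eq_zero_of_unique_root {P : Polynomial ℂ} {a : ℂ} (hP : 2 ≤ P.natDegree)
    (h : ∀ z, P.eval z = 0 → z = a) : P.derivative.eval a = 0 := by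
  have hroot : ∀ R : Polynomial ℂ, R.natDegree ≠ 0 → ∃ z, R.eval z = 0 := fun R hR =>
    IsAlgClosed.exists_root R fun h0 => hR (Polynomial.natDegree_eq_of_degree_eq_some h0)
  obtain ⟨z, hz⟩ := hroot P (by omega)
  obtain rfl := h z hz
  obtain ⟨R, rfl⟩ := Polynomial.dvd_iff_isRoot.2 hz
  have hR : R.natDegree ≠ 0 := by
    intro h0
    have := Polynomial.natDegree_mul_le (p := Polynomial.X - Polynomial.C z) (q := R)
    rw [Polynomial.natDegree_X_sub_C] at this
    omega
  obtain ⟨y, hy⟩ := hroot R hR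
  have hyz := h y (by simp [hy])
  rw [hyz] at hy
  simp [hy]

/-- A rational map of degree at least two has a fixed point together with a second point that is
fixed or maps to it. -/
theorem IsRationalMap.exists_fixed_and_eventually_fixed {d : ℕ} {f : OnePoint ℂ → OnePoint ℂ} (hd : 2 ≤ d)
    (hf : IsRationalMap d f) : ∃ a b, a ≠ b ∧ f a = a ∧ (f b = a ∨ f b = b) := by
  obtain ⟨p, q, hpq, hmax, hf, hinf⟩ := hf
  have hp : p.natDegree ≤ d := hmax ▸ le_max_left _ _
  have hq : q.natDegree ≤ d := hmax ▸ le_max_right _ _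
  have hroot : ∀ R : Polynomial ℂ, R.natDegree ≠ 0 → ∃ z, R.eval z = 0 := fun R hR =>
    IsAlgClosed.exists_root R fun h0 => hR (Polynomial.natDegree_eq_of_degree_eq_some h0)
  have hfix : ∀ z : ℂ, f z = z ↔ (p - Polynomial.X * q).eval z = 0 := fun z => by
    rw [hf, ratio_eq_coe_iff (eval_ne_zero_of_isCoprime hpq)]
    simp [sub_eq_zero]
  by_contra! H
  -- If `∞` is fixed, it has no other preimage, so `q` is constant and `f` is a polynomial; but a
  -- polynomial of degree at least two has a finite fixed point.
  by_cases hq0 : q.coeff d = 0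
  · have hfi : f OnePoint.infty = OnePoint.infty := by rw [hinf, hq0, ratio_zero_right]
    have hqc : q.natDegree = 0 := by
      by_contra hne
      obtain ⟨z, hz⟩ := hroot q hne
      exact (H _ z (OnePoint.infty_ne_coe z) hfi).1 (by rw [hf, hz, ratio_zero_right])
    have hpd : p.natDegree = d := by rw [hqc] at hmax; simpa using hmax
    have hdeg : (p - Polynomial.X * q).natDegree ≠ 0 := by
      have h1 : (Polynomial.X * q).natDegree ≤ 1 + 0 := by
        rw [← hqc]
        exact Polynomial.natDegree_mul_le.trans (by simp)
      rw [Polynomial.natDegree_sub_eq_left_of_natDegree_lt (by omega)]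
      omega
    obtain ⟨z, hz⟩ := hroot _ hdeg
    exact (H _ z (OnePoint.infty_ne_coe z) hfi).2 ((hfix z).2 hz)
  -- If `∞` is not fixed, some finite `a` is. It is the only root of both `p - X * q` and `p - a *
  -- q`, hence a multiple root of each. The two derivatives at `a` differ by `q a`, so `q`, and then
  -- `p`, vanishes at `a`.
  · have hqd : q.natDegree = d := le_antisymm hq (Polynomial.le_natDegree_of_ne_zero hq0)
    have hqne : q ≠ 0 := by rintro rfl; simp at hq0
    have hXq : (Polynomial.X * q).natDegree = d + 1 := by
      rw [Polynomial.natDegree_X_mul hqne, hqd]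
    have hdeg : (p - Polynomial.X * q).natDegree = d + 1 := by
      rw [Polynomial.natDegree_sub_eq_right_of_natDegree_lt (by omega), hXq]
    obtain ⟨a, ha⟩ := hroot (p - Polynomial.X * q) (by omega)
    have hfa := (hfix a).2 ha
    have hda := eval_derivative_eq_zero_of_unique_root (P := p - Polynomial.X * q)
      (a := a) (by omega) fun z hz => by
      by_contra hne
      exact (H a z (fun h => hne (OnePoint.coe_injective h).symm) hfa).2 ((hfix z).2 hz)
    have hdeg' : 2 ≤ (p - Polynomial.C a * q).natDegree := by
      refine hd.trans (Polynomial.le_natDegree_of_ne_zero ?_)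
      rw [Polynomial.coeff_sub, Polynomial.coeff_C_mul]
      intro h0
      refine (H a OnePoint.infty (OnePoint.coe_ne_infty a) hfa).1 ?_
      rw [hinf, ratio_eq_coe_iff fun h => absurd h hq0]
      exact sub_eq_zero.1 h0
    have hda' := eval_derivative_eq_zero_of_unique_root (a := a) hdeg' fun z hz => by
      by_contra hne
      refine (H a z (fun h => hne (OnePoint.coe_injective h).symm) hfa).1 ?_
      rw [hf, ratio_eq_coe_iff (eval_ne_zero_of_isCoprime hpq)]
      simpa [sub_eq_zero] using hz
    have hqa : q.eval a = 0 := by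
      simp at hda hda'
      linear_combination hda' - hda
    refine eval_ne_zero_of_isCoprime hpq hqa ?_
    simpa [hqa] using ha

theorem eventually_notMem_of_finite {s : Set ℂ} (hs : s.Finite) (z : ℂ) :
    ∀ᶠ w in 𝓝[≠] z, w ∉ s := by
  rw [eventually_nhdsWithin_iff]
  filter_upwards [(hs.subset (sdiff_subset (t := {z}))).isClosed.isOpen_compl.mem_nhds
    (by simp : z ∈ (s \ {z})ᶜ)] with w hw hwz hws
  exact hw ⟨hws, hwz⟩

/-- Preperiodic points persist: nearby rational maps have two uniformly separated points that
become fixed after at most one step. -/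
theorem eventually_exists_separated {ι : Type*} {l : Filter ι}
    {f : ι → OnePoint ℂ → OnePoint ℂ} {g : OnePoint ℂ → OnePoint ℂ}
    (hf : ∀ i, ∃ d, 2 ≤ d ∧ IsRationalMap d (f i)) (hg : ∃ d, 2 ≤ d ∧ IsRationalMap d g)
    (hfg : TendstoUniformly f g l) :
    ∃ δ > 0, ∀ᶠ i in l, ∃ a b, δ ≤ dist a b ∧ f i (f i a) = f i a ∧ f i (f i b) = f i b := by
  obtain ⟨d, hd, hgd⟩ := hg
  have hd0 : d ≠ 0 := by omega
  have hparam : ∀ {χ : ℂ → OnePoint ℂ},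
      TendstoLocallyUniformlyOn (fun i w => f i (χ w)) (fun w => g (χ w)) l univ := fun {χ} =>
    (hfg.comp χ).tendstoUniformlyOn.tendstoLocallyUniformlyOn
  have fixed : ∀ a, g a = a → ∀ V ∈ 𝓝 a, ∀ᶠ i in l, ∃ a' ∈ V, f i a' = a' := by
    intro a ha V hV
    obtain ⟨χ, z, rfl, hχ, hinj, hrat⟩ := exists_parametrization a
    have hV' : χ ⁻¹' V ∈ 𝓝 z := (hχ.1.continuousAt univ_mem) hV
    obtain ⟨r, hr, hrV⟩ := Metric.mem_nhds_iff.1 hV'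
    have key := eventually_exists_eq_of_tendstoLocallyUniformlyOn (l := l) isOpen_univ
      (.of_forall fun i => by
        obtain ⟨d, hd, hfd⟩ := hf i
        exact hrat d _ (by omega) hfd) (.of_forall fun i => hχ) hparam
      (fun s hs x _ => ⟨univ, univ_mem, .of_forall fun _ _ _ => refl_mem_uniformity hs⟩)
      (hrat d g hd0 hgd).1 hχ.1 (mem_univ z) ha
      (eventually_notMem_of_finite ((hgd.finite_fixedPoints hd).preimage hinj.injOn) z) hr
    filter_upwards [key] with i hi
    obtain ⟨w, hw, -, hw'⟩ := hi
    exact ⟨χ w, hrV hw, hw'⟩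
  -- The target must vary together with the map, since the fixed point near `a` moves with `i`;
  -- hence the product filter.
  have mapped : ∀ a b, g b = a → ∀ V ∈ 𝓝 b,
      ∀ᶠ x : ι × OnePoint ℂ in l ×ˢ 𝓝 a, ∃ b' ∈ V, f x.1 b' = x.2 := by
    intro a b hb V hV
    obtain ⟨χ, z, rfl, hχ, hinj, hrat⟩ := exists_parametrization b
    have hV' : χ ⁻¹' V ∈ 𝓝 z := (hχ.1.continuousAt univ_mem) hV
    obtain ⟨r, hr, hrV⟩ := Metric.mem_nhds_iff.1 hV'
    have key := eventually_exists_eq_of_tendstoLocallyUniformlyOn (l := l ×ˢ 𝓝 a)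
      (u := fun x w => f x.1 (χ w)) (v := fun x _ => x.2) (v₀ := fun _ => a) isOpen_univ
      (.of_forall fun i => by
        obtain ⟨d, hd, hfd⟩ := hf i.1
        exact hrat d _ (by omega) hfd) (.of_forall fun i => holomorphicOn_const _ _)
      (fun s hs x hx => by
        obtain ⟨t, ht, h⟩ := hparam (χ := χ) s hs x hx
        exact ⟨t, ht, tendsto_fst.eventually h⟩)
      (tendstoLocallyUniformlyOn_const tendsto_snd univ)
      (hrat d g hd0 hgd).1 continuousOn_const (mem_univ z) hb
      (eventually_notMem_of_finite ((hgd.finite_fiber hd0 a).preimage hinj.injOn) z) hr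
    filter_upwards [key] with i hi
    obtain ⟨w, hw, -, hw'⟩ := hi
    exact ⟨χ w, hrV hw, hw'⟩
  obtain ⟨a, b, hab, ha, hb⟩ := hgd.exists_fixed_and_eventually_fixed hd
  have hδ : 0 < dist a b := dist_pos.2 hab
  have hsep : ∀ {a' b'}, a' ∈ Metric.ball a (dist a b / 3) → b' ∈ Metric.ball b (dist a b / 3) →
      dist a b / 3 ≤ dist a' b' := by
    intro a' b' h1 h2
    have h3 := dist_triangle4_right a b a' b'
    rw [Metric.mem_ball, dist_comm] at h1 h2
    linarith
  have hVa := Metric.ball_mem_nhds a (by linarith : 0 < dist a b / 3)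
  have hVb := Metric.ball_mem_nhds b (by linarith : 0 < dist a b / 3)
  refine ⟨dist a b / 3, by linarith, ?_⟩
  rcases hb with hb | hb
  · obtain ⟨P, hP, Q, hQ, hPQ⟩ := eventually_prod_iff.1 (mapped a b hb _ hVb)
    filter_upwards [hP, fixed a ha _ (inter_mem hVa hQ)] with i hi hi'
    obtain ⟨a', ha', hfa'⟩ := hi'
    obtain ⟨b', hb', hfb'⟩ := hPQ hi ha'.2
    have hfb' : f i b' = a' := hfb'
    exact ⟨a', b', hsep ha'.1 hb', by rw [hfa', hfa'], by rw [hfb', hfa']⟩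
  · filter_upwards [fixed a ha _ hVa, fixed b hb _ hVb] with i hi hi'
    obtain ⟨a', ha', hfa'⟩ := hi
    obtain ⟨b', hb', hfb'⟩ := hi'
    exact ⟨a', b', hsep ha' hb', by rw [hfa', hfa'], by rw [hfb', hfb']⟩

/-! ### Limits of strip maps -/

theorem isOpen_standardStrip (L : ℝ) : IsOpen (standardStrip L) :=
  isOpen_lt (continuous_abs.comp Complex.continuous_im) continuous_const

theorem convex_standardStrip (L : ℝ) : Convex ℝ (standardStrip L) := by
  have : standardStrip L = Complex.imLm ⁻¹' Ioo (-L) L := by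
    ext z
    exact abs_lt (a := z.im)
  rw [this]
  exact (convex_Ioo (-L) L).linear_preimage _

theorem ofReal_mem_standardStrip {L : ℝ} (hL : 0 < L) (x : ℝ) : (x : ℂ) ∈ standardStrip L := by
  simpa [standardStrip] using hL

theorem add_ofReal_mem_standardStrip {L : ℝ} {z : ℂ} (hz : z ∈ standardStrip L) (t : ℝ) :
    z + t ∈ standardStrip L := by
  simpa [standardStrip] using hz

theorem sub_one_mem_standardStrip {L : ℝ} {z : ℂ} (hz : z ∈ standardStrip L) :
    z - 1 ∈ standardStrip L := by
  simpa [standardStrip] using hz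

/-- `h` is a conformal isomorphism of the standard strip to its image that conjugates `z ↦ z - 1`
to `f`. -/
structure IsStripMap (L : ℝ) (f : OnePoint ℂ → OnePoint ℂ) (h : ℂ → OnePoint ℂ) : Prop where
  holomorphicOn : HolomorphicOn h (standardStrip L)
  injOn : InjOn h (standardStrip L)
  conj : ∀ z ∈ standardStrip L, f (h z) = h (z - 1)

theorem IsStripMap.translate {L : ℝ} {f : OnePoint ℂ → OnePoint ℂ} {h : ℂ → OnePoint ℂ}
    (hh : IsStripMap L f h) (t : ℝ) : IsStripMap L f fun z => h (z + t) where
  holomorphicOn := hh.holomorphicOn.comp (fun _ _ => by fun_prop)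
    fun _ hz => add_ofReal_mem_standardStrip hz t
  injOn _ hz _ hw h := add_right_cancel (hh.injOn (add_ofReal_mem_standardStrip hz t)
    (add_ofReal_mem_standardStrip hw t) h)
  conj z hz := by rw [hh.conj _ (add_ofReal_mem_standardStrip hz t), add_sub_right_comm]

/-- Otherwise `h (z - 2) = h (z - 1)`, against injectivity. This supplies the omitted values. -/
theorem IsStripMap.ne_of_map_map_eq {L : ℝ} {f : OnePoint ℂ → OnePoint ℂ} {h : ℂ → OnePoint ℂ}
    (hh : IsStripMap L f h) {a : OnePoint ℂ} (ha : f (f a) = f a) {z : ℂ}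
    (hz : z ∈ standardStrip L) : h z ≠ a := by
  rintro rfl
  have hz1 := sub_one_mem_standardStrip hz
  rw [hh.conj z hz, hh.conj _ hz1] at ha
  have := hh.injOn (sub_one_mem_standardStrip hz1) hz1 ha
  rw [sub_eq_self] at this
  exact one_ne_zero this

theorem IsStripMap.map_ne_self {L : ℝ} {f : OnePoint ℂ → OnePoint ℂ} {h : ℂ → OnePoint ℂ}
    (hh : IsStripMap L f h) {z : ℂ} (hz : z ∈ standardStrip L) : f (h z) ≠ h z :=
  fun h' => hh.ne_of_map_map_eq (congrArg f h') hz rfl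

/-- The pointwise limit along an ultrafilter of maps to the sphere. -/
noncomputable def limitMap {ι : Type*} (U : Ultrafilter ι) (h : ι → ℂ → OnePoint ℂ) (z : ℂ) :
    OnePoint ℂ :=
  (U.map fun i => h i z).lim

theorem tendsto_limitMap {ι : Type*} (U : Ultrafilter ι) (h : ι → ℂ → OnePoint ℂ) (z : ℂ) :
    Tendsto (fun i => h i z) U (𝓝 (limitMap U h z)) :=
  (U.map fun i => h i z).le_nhds_lim

section Limit

variable {ι : Type*} {U : Ultrafilter ι} {L : ℝ} {f : ι → OnePoint ℂ → OnePoint ℂ}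
  {g : OnePoint ℂ → OnePoint ℂ}

/-- The normal family argument: strip maps of `f i` omit two uniformly separated points, so they are
eventually equi-Lipschitz near each point, and the pointwise limit along the ultrafilter is locally
uniform. -/
theorem tendstoLocallyUniformlyOn_limitMap (hf : ∀ i, ∃ d, 2 ≤ d ∧ IsRationalMap d (f i))
    (hg : ∃ d, 2 ≤ d ∧ IsRationalMap d g) (hfg : TendstoUniformly f g U) {h : ι → ℂ → OnePoint ℂ}
    (hh : ∀ i, IsStripMap L (f i) (h i)) :
    TendstoLocallyUniformlyOn h (limitMap U h) U (standardStrip L) := by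
  obtain ⟨δ, hδ, hsep⟩ := eventually_exists_separated hf hg hfg
  rw [Metric.tendstoLocallyUniformlyOn_iff]
  intro ε hε z hz
  obtain ⟨ρ, hρ, hsub⟩ := Metric.isOpen_iff.1 (isOpen_standardStrip L) z hz
  set R := ρ / 2 with hR
  have hR0 : 0 < R := half_pos hρ
  have hsub : Metric.ball z (2 * R) ⊆ standardStrip L := by
    rw [hR, mul_div_cancel₀ ρ two_ne_zero]
    exact hsub
  set K := 3200 / (δ * R)
  have hK : 0 < K := by positivity
  have hlip : ∀ᶠ i in (U : Filter ι), ∀ x ∈ Metric.ball z (R / 800), ∀ y ∈ Metric.ball z (R / 800),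
      dist (h i x) (h i y) ≤ K * ‖x - y‖ := by
    filter_upwards [hsep] with i hi x hx y hy
    obtain ⟨a, b, hab, ha, hb⟩ := hi
    exact ((hh i).holomorphicOn.mono hsub).dist_le_of_injOn_of_omits hR0 ((hh i).injOn.mono hsub)
      hδ hab (fun w hw => (hh i).ne_of_map_map_eq ha (hsub hw))
      (fun w hw => (hh i).ne_of_map_map_eq hb (hsub hw)) hx hy
  set s := min (R / 800) (ε / (3 * K))
  have hs : 0 < s := lt_min (by positivity) (by positivity)
  have hsmall : ∀ x ∈ Metric.ball z s, x ∈ Metric.ball z (R / 800) ∧ K * ‖x - z‖ < ε / 3 := by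
    intro x hx
    refine ⟨Metric.ball_subset_ball (min_le_left _ _) hx, ?_⟩
    have h1 : ‖x - z‖ < ε / (3 * K) := by
      rw [← dist_eq_norm]
      exact (Metric.mem_ball.1 hx).trans_le (min_le_right _ _)
    calc K * ‖x - z‖ < K * (ε / (3 * K)) := by gcongr
      _ = ε / 3 := by field_simp
  have hz' : z ∈ Metric.ball z (R / 800) := Metric.mem_ball_self (by positivity)
  have hlim : ∀ x ∈ Metric.ball z s, dist (limitMap U h x) (limitMap U h z) ≤ ε / 3 := by
    intro x hx
    refine le_of_tendsto ((tendsto_limitMap U h x).dist (tendsto_limitMap U h z)) ?_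
    filter_upwards [hlip] with i hi
    exact (hi x (hsmall x hx).1 z hz').trans (hsmall x hx).2.le
  refine ⟨Metric.ball z s, mem_nhdsWithin_of_mem_nhds (Metric.ball_mem_nhds z hs), ?_⟩
  filter_upwards [hlip, Metric.tendsto_nhds.1 (tendsto_limitMap U h z) (ε / 3) (by positivity)]
    with i hi hi' x hx
  have h1 := hi x (hsmall x hx).1 z hz'
  have h2 := (hsmall x hx).2
  have h3 := hlim x hx
  have h4 := dist_triangle4 (limitMap U h x) (limitMap U h z) (h i z) (h i x)
  rw [dist_comm (limitMap U h z), dist_comm (h i z) (h i x)] at h4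
  linarith

/-- A limit of strip maps is a strip map of the limit or constant. -/
theorem isStripMap_limitMap_or_const (hf : ∀ i, ∃ d, 2 ≤ d ∧ IsRationalMap d (f i))
    (hg : ∃ d, 2 ≤ d ∧ IsRationalMap d g) (hfg : TendstoUniformly f g U) {h : ι → ℂ → OnePoint ℂ}
    (hh : ∀ i, IsStripMap L (f i) (h i)) :
    IsStripMap L g (limitMap U h) ∨
      ∃ p, g p = p ∧ ∀ z ∈ standardStrip L, limitMap U h z = p := by
  have hl := tendstoLocallyUniformlyOn_limitMap hf hg hfg hh
  have hol : ∀ᶠ i in (U : Filter ι), HolomorphicOn (h i) (standardStrip L) :=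
    .of_forall fun i => (hh i).holomorphicOn
  have hopen := isOpen_standardStrip L
  have hgc : Continuous g := by
    obtain ⟨d, hd, hgd⟩ := hg
    exact hgd.continuous (by omega)
  have hconj : ∀ z ∈ standardStrip L, g (limitMap U h z) = limitMap U h (z - 1) := by
    intro z hz
    have h1 : Tendsto (fun i => f i (h i z)) U (𝓝 (g (limitMap U h z))) :=
      hfg.tendsto_comp hgc.continuousAt (tendsto_limitMap U h z)
    have h2 := tendsto_limitMap U h (z - 1)
    simp only [(hh _).conj z hz] at h1
    exact tendsto_nhds_unique h1 h2
  rcases injOn_or_const_of_tendstoLocallyUniformlyOn hopen (convex_standardStrip L).isPreconnected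
    hol (.of_forall fun i => (hh i).injOn) hl with hi | ⟨p, hp⟩
  · exact Or.inl ⟨.of_tendstoLocallyUniformlyOn hopen hol hl, hi, hconj⟩
  -- The sign of `L` is arbitrary here; on an empty strip every map is a strip map.
  · rcases (standardStrip L).eq_empty_or_nonempty with he | ⟨z, hz⟩
    · left
      rw [he] at hl hol
      refine ⟨?_, ?_, ?_⟩ <;> rw [he]
      · exact .of_tendstoLocallyUniformlyOn isOpen_empty hol hl
      · exact injOn_empty _
      · simp
    · right
      refine ⟨p, ?_, hp⟩
      have := hconj z hz
      rwa [hp z hz, hp _ (sub_one_mem_standardStrip hz)] at this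

/-- Values of an injective limit are attained nearby. -/
theorem eventually_exists_eq_limitMap (hf : ∀ i, ∃ d, 2 ≤ d ∧ IsRationalMap d (f i))
    (hg : ∃ d, 2 ≤ d ∧ IsRationalMap d g) (hfg : TendstoUniformly f g U) {h : ι → ℂ → OnePoint ℂ}
    (hh : ∀ i, IsStripMap L (f i) (h i)) (hlim : IsStripMap L g (limitMap U h)) {z : ℂ}
    (hz : z ∈ standardStrip L) {r : ℝ} (hr : 0 < r) :
    ∀ᶠ i in (U : Filter ι), ∃ w ∈ Metric.ball z r, w ∈ standardStrip L ∧
      h i w = limitMap U h z :=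
  eventually_exists_eq_of_tendstoLocallyUniformlyOn (isOpen_standardStrip L)
    (.of_forall fun i => (hh i).holomorphicOn) (.of_forall fun _ => holomorphicOn_const _ _)
    (tendstoLocallyUniformlyOn_limitMap hf hg hfg hh)
    (tendstoLocallyUniformlyOn_const (tendsto_const_nhds (x := limitMap U h z)) _)
    hlim.holomorphicOn.1 continuousOn_const hz rfl
    (eventually_ne_of_injOn (isOpen_standardStrip L) hlim.injOn hz) hr

/-- Two limits of reparametrizations of the same strips have disjoint images unless they differ
by a real translation. -/
theorem exists_translate_of_limitMap_eq (hf : ∀ i, ∃ d, 2 ≤ d ∧ IsRationalMap d (f i))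
    (hg : ∃ d, 2 ≤ d ∧ IsRationalMap d g) (hfg : TendstoUniformly f g U) {h : ι → ℂ → OnePoint ℂ}
    (hh : ∀ i, IsStripMap L (f i) (h i)) {t t' : ι → ℝ}
    (ht : IsStripMap L g (limitMap U fun i z => h i (z + t i)))
    (ht' : IsStripMap L g (limitMap U fun i z => h i (z + t' i))) {z z' : ℂ}
    (hz : z ∈ standardStrip L) (hz' : z' ∈ standardStrip L)
    (heq : limitMap U (fun i z => h i (z + t i)) z = limitMap U (fun i z => h i (z + t' i)) z') :
    ∃ c : ℝ, ∀ x ∈ standardStrip L,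
      limitMap U (fun i z => h i (z + t' i)) x = limitMap U (fun i z => h i (z + t i)) (x + c) := by
  have e1 := eventually_exists_eq_limitMap hf hg hfg (fun i => (hh i).translate (t i)) ht hz one_pos
  have e2 := eventually_exists_eq_limitMap hf hg hfg (fun i => (hh i).translate (t' i)) ht' hz'
    one_pos
  -- The common value is attained by both translates near `z` and `z'`. Injectivity of `h i`
  -- identifies the two parameters, which bounds the difference of the shifts; its limit along the
  -- ultrafilter is `c`.
  have hbdd : ∀ᶠ i in (U : Filter ι), t' i - t i ∈ Metric.closedBall (0 : ℝ) (dist z z' + 2) := by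
    filter_upwards [e1, e2] with i hi hi'
    obtain ⟨w, hw, hwS, hwe⟩ := hi
    obtain ⟨w', hw', hwS', hwe'⟩ := hi'
    have h1 : w + t i = w' + t' i := (hh i).injOn (add_ofReal_mem_standardStrip hwS _)
      (add_ofReal_mem_standardStrip hwS' _) (by rw [hwe, hwe', heq])
    have h2 : ((t' i - t i : ℝ) : ℂ) = w - w' := by
      push_cast
      linear_combination -h1
    rw [mem_closedBall_zero_iff, ← Complex.norm_real, h2, ← dist_eq_norm]
    have h3 := dist_triangle4 w z z' w'
    have h4 := Metric.mem_ball.1 hw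
    have h5 := Metric.mem_ball'.1 hw'
    linarith
  obtain ⟨c, -, hc⟩ := (isCompact_closedBall (0 : ℝ) (dist z z' + 2)).ultrafilter_le_nhds
    (U.map fun i => t' i - t i) (le_principal_iff.2 hbdd)
  have hc : Tendsto (fun i => t' i - t i) U (𝓝 c) := hc
  refine ⟨c, fun x hx => ?_⟩
  have hxc := add_ofReal_mem_standardStrip hx c
  have hcx : Tendsto (fun i => x + ((t' i - t i : ℝ) : ℂ)) U (𝓝 (x + c)) :=
    tendsto_const_nhds.add ((Complex.continuous_ofReal.tendsto c).comp hc)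
  have hl := tendstoLocallyUniformlyOn_limitMap hf hg hfg (fun i => (hh i).translate (t i))
  have h1 := tendsto_comp_of_locally_uniform_limit_within
    (ht.holomorphicOn.1 (x + c) hxc) (tendsto_nhdsWithin_iff.2 ⟨hcx,
      .of_forall fun i => add_ofReal_mem_standardStrip hx _⟩) (fun u hu => hl u hu _ hxc)
  refine tendsto_nhds_unique (tendsto_limitMap U _ x) (h1.congr fun i => ?_)
  congr 1
  push_cast
  ring

end Limit

/-- The ends of the central line of a strip accumulate only at fixed points. -/
theorem IsStripMap.exists_tendsto_fixed {L : ℝ} (hL : 0 < L) {g : OnePoint ℂ → OnePoint ℂ}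
    (hg : ∃ d, 2 ≤ d ∧ IsRationalMap d g) {k : ℂ → OnePoint ℂ} (hk : IsStripMap L g k)
    {V : Ultrafilter ℝ} (hV : (V : Filter ℝ) ≤ cocompact ℝ) :
    ∃ p, g p = p ∧ Tendsto (fun x : ℝ => k x) V (𝓝 p) := by
  have hgg : TendstoUniformly (fun _ : ℝ => g) g V :=
    fun s hs => .of_forall fun _ _ => refl_mem_uniformity hs
  have h0 : (0 : ℂ) ∈ standardStrip L := by simpa using ofReal_mem_standardStrip hL 0
  -- The translates of the single map `k`, indexed by the shift itself, are treated as a family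
  -- converging along `V`. If the limit were injective, its value at `0` would be taken by `k` near
  -- arbitrarily distant shifts.
  rcases isStripMap_limitMap_or_const (f := fun _ : ℝ => g) (U := V) (fun _ => hg) hg hgg
    (fun x => hk.translate x) with hinj | ⟨p, hp, hpS⟩
  · exfalso
    have hev := eventually_exists_eq_limitMap (f := fun _ : ℝ => g) (fun _ => hg) hg hgg
      (fun x => hk.translate x) hinj h0 one_pos
    obtain ⟨x, w, hw, hwS, hwe⟩ := hev.exists
    have hfar : ∀ᶠ y in (V : Filter ℝ), y ∉ Metric.closedBall x 2 :=
      hV (isCompact_closedBall x 2).compl_mem_cocompact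
    obtain ⟨y, ⟨w', hw', hwS', hwe'⟩, hy⟩ := (hev.and hfar).exists
    have h1 := hk.injOn (add_ofReal_mem_standardStrip hwS x) (add_ofReal_mem_standardStrip hwS' y)
      (hwe.trans hwe'.symm)
    apply hy
    have h2 : ((y - x : ℝ) : ℂ) = w - w' := by
      push_cast
      linear_combination -h1
    rw [Metric.mem_closedBall, dist_eq_norm, ← Complex.norm_real, h2]
    have h3 := norm_sub_le w w'
    rw [mem_ball_zero_iff] at hw hw'
    linarith
  · refine ⟨p, hp, ?_⟩
    have h1 := tendsto_limitMap V (fun (x : ℝ) z => k (z + x)) 0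
    rw [hpS 0 h0] at h1
    simpa using h1

/-! ### Transition maps between conformal isomorphisms -/

/-- `φ₂` is an open injection, so its inverse is continuous. -/
theorem continuousAt_of_comp_eq {φ₁ φ₂ : ℂ → OnePoint ℂ} {U₁ U₂ : Set ℂ} (hU₁ : IsOpen U₁)
    (hU₂ : IsOpen U₂) (h₁ : ContinuousOn φ₁ U₁) (h₂ : HolomorphicOn φ₂ U₂) (hi₂ : InjOn φ₂ U₂)
    {θ : ℂ → ℂ} (hm : MapsTo θ U₁ U₂) (hθ : ∀ z ∈ U₁, φ₂ (θ z) = φ₁ z) {z : ℂ} (hz : z ∈ U₁) :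
    ContinuousAt θ z := by
  intro V hV
  obtain ⟨W, hWV, hW, hzW⟩ := mem_nhds_iff.1 (inter_mem hV (hU₂.mem_nhds (hm hz)))
  have hWU : W ⊆ U₂ := hWV.trans inter_subset_right
  have hopen : φ₂ '' W ∈ 𝓝 (φ₁ z) := by
    rw [← hθ z hz]
    exact (h₂.isOpen_image hi₂ hW hWU).mem_nhds (mem_image_of_mem _ hzW)
  have hpre : φ₁ ⁻¹' (φ₂ '' W) ∈ 𝓝 z := h₁.continuousAt (hU₁.mem_nhds hz) hopen
  change θ ⁻¹' V ∈ 𝓝 z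
  filter_upwards [hU₁.mem_nhds hz, hpre] with x hx hx'
  obtain ⟨w, hw, hwx⟩ := hx'
  rw [← hθ x hx] at hwx
  rw [mem_preimage, ← hi₂ (hWU hw) (hm hx) hwx]
  exact (hWV hw).1

/-- A transition map between two conformal parametrizations is holomorphic. -/
theorem differentiableAt_of_comp_eq {φ₁ φ₂ : ℂ → OnePoint ℂ} {U₁ U₂ : Set ℂ} (hU₁ : IsOpen U₁)
    (hU₂ : IsOpen U₂) (h₁ : HolomorphicOn φ₁ U₁) (hi₁ : InjOn φ₁ U₁) (h₂ : HolomorphicOn φ₂ U₂)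
    (hi₂ : InjOn φ₂ U₂) {θ : ℂ → ℂ} (hm : MapsTo θ U₁ U₂) (hθ : ∀ z ∈ U₁, φ₂ (θ z) = φ₁ z) {z : ℂ}
    (hz : z ∈ U₁) : DifferentiableAt ℂ θ z := by
  have hcont : ∀ x ∈ U₁, ContinuousAt θ x := fun x hx =>
    continuousAt_of_comp_eq hU₁ hU₂ h₁.1 h₂ hi₂ hm hθ hx
  obtain ⟨κ, q, hκ, hq⟩ := exists_isChart (φ₁ z)
  set F₁ : ℂ → ℂ := fun w => κ (φ₁ w)
  set F₂ : ℂ → ℂ := fun w => κ (φ₂ w)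
  have hev₂ : ∀ᶠ w in 𝓝 (θ z), w ∈ U₂ ∧ φ₂ w ≠ q :=
    (hU₂.eventually_mem (hm hz)).and ((h₂.1.continuousAt (hU₂.mem_nhds (hm hz))).eventually_ne
      (by rwa [hθ z hz]))
  have han : ∀ w, (∀ᶠ v in 𝓝 w, v ∈ U₂ ∧ φ₂ v ≠ q) → AnalyticAt ℂ F₂ w := fun w hw => by
    rw [Complex.analyticAt_iff_eventually_differentiableAt]
    filter_upwards [hw] with v hv using hκ.differentiableAt h₂ hv.1 hv.2
  -- Injectivity keeps `F₂` from being locally constant, so the zeros of its derivative are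
  -- isolated. The inverse function theorem applies off `z`, and the singularity at `z` is removed
  -- by continuity.
  have hderiv : ∀ᶠ w in 𝓝[≠] (θ z), deriv F₂ w ≠ 0 := by
    rcases (han _ hev₂).deriv.eventually_eq_zero_or_eventually_ne_zero with h | h
    · exfalso
      obtain ⟨r, hr, hball⟩ := Metric.mem_nhds_iff.1 (h.and hev₂)
      have hconst : ∀ w ∈ Metric.ball (θ z) r, F₂ w = F₂ (θ z) := fun w hw =>
        Metric.isOpen_ball.is_const_of_deriv_eq_zero (convex_ball (θ z) r).isPreconnected
          (fun v hv => (hκ.differentiableAt h₂ (hball hv).2.1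
            (hball hv).2.2).differentiableWithinAt)
          (fun v hv => (hball hv).1) hw (Metric.mem_ball_self hr)
      obtain ⟨w, hw, hw'⟩ := ((eventually_ne_of_injOn hU₂ hi₂ (hm hz)).and
        (nhdsWithin_le_nhds (Metric.ball_mem_nhds (θ z) hr))).exists
      exact hw (hκ.injOn (hball hw').2.2 (by rw [mem_compl_singleton_iff, hθ z hz]; exact hq)
        (hconst w hw'))
    · exact h
  have htend : Tendsto θ (𝓝[≠] z) (𝓝[≠] (θ z)) := by
    refine tendsto_nhdsWithin_iff.2 ⟨(hcont z hz).tendsto.mono_left nhdsWithin_le_nhds, ?_⟩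
    filter_upwards [self_mem_nhdsWithin, nhdsWithin_le_nhds (hU₁.mem_nhds hz)] with w hw hwU h
    have h : θ w = θ z := h
    exact hw (hi₁ hwU hz (by rw [← hθ w hwU, ← hθ z hz, h]))
  refine (Complex.analyticAt_of_differentiable_on_punctured_nhds_of_continuousAt ?_
    (hcont z hz)).differentiableAt
  filter_upwards [htend.eventually hderiv, nhdsWithin_le_nhds (hU₁.mem_nhds hz),
    nhdsWithin_le_nhds ((hcont z hz).eventually hev₂.eventually_nhds)] with x hx hxU hx₂
  have hs : HasStrictDerivAt F₂ (deriv F₂ (θ x)) (θ x) :=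
    (han _ hx₂).hasStrictDerivAt
  have hloc := (hs.to_localInverse hx).hasDerivAt.differentiableAt
  have hF₁ : DifferentiableAt ℂ F₁ x := by
    refine hκ.differentiableAt h₁ hxU ?_
    rw [← hθ x hxU]
    exact hx₂.self_of_nhds.2
  have hval : F₁ x = F₂ (θ x) := by simp only [F₁, F₂, hθ x hxU]
  rw [← hval] at hloc
  refine (hloc.comp x hF₁).congr_of_eventuallyEq ?_
  filter_upwards [hU₁.mem_nhds hxU,
    (hcont x hxU).eventually (hs.eventually_left_inverse hx)] with v hv hv'
  have e : F₁ v = F₂ (θ v) := by simp only [F₁, F₂, hθ v hv]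
  rw [Function.comp_apply, e, hv']

/-! ### The Schwarz-Pick lemma in the upper half-plane -/

theorem le_of_tanh_le_tanh {x y : ℝ} (h : Real.tanh x ≤ Real.tanh y) : x ≤ y := by
  rw [Real.tanh_eq_sinh_div_cosh, Real.tanh_eq_sinh_div_cosh,
    div_le_div_iff₀ (Real.cosh_pos x) (Real.cosh_pos y)] at h
  have h1 := Real.sinh_sub x y
  have h2 : Real.sinh (x - y) ≤ 0 := by linarith
  linarith [Real.sinh_nonpos_iff.1 h2]

/-- The Cayley transform centred at `w` maps exactly the upper half-plane into the unit disc. -/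
theorem norm_sub_lt_norm_sub_conj_iff {z w : ℂ} (hw : 0 < w.im) :
    ‖z - w‖ < ‖z - (starRingEnd ℂ) w‖ ↔ 0 < z.im := by
  rw [← sq_lt_sq₀ (norm_nonneg _) (norm_nonneg _), Complex.sq_norm, Complex.sq_norm,
    Complex.normSq_apply, Complex.normSq_apply]
  simp only [Complex.sub_re, Complex.sub_im, Complex.conj_re, Complex.conj_im]
  constructor
  · intro h
    by_contra! h'
    nlinarith
  · intro h
    nlinarith [mul_pos h hw]

theorem sub_conj_ne_zero {z w : ℂ} (hz : 0 < z.im) (hw : 0 < w.im) :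
    z - (starRingEnd ℂ) w ≠ 0 :=
  norm_pos_iff.1 ((norm_nonneg _).trans_lt ((norm_sub_lt_norm_sub_conj_iff hw).2 hz))

/-- Cayley transforms centred at `w` and `F w` reduce this to the Schwarz lemma at `0`; the modulus
of the transform is `tanh` of half the hyperbolic distance. -/
theorem dist_le_dist_of_mapsTo_upperHalfPlane {F : ℂ → ℂ}
    (hd : ∀ z : ℂ, 0 < z.im → DifferentiableAt ℂ F z) (hm : ∀ z : ℂ, 0 < z.im → 0 < (F z).im)
    (z w : UpperHalfPlane) :
    dist (⟨F z, hm z z.im_pos⟩ : UpperHalfPlane) ⟨F w, hm w w.im_pos⟩ ≤ dist z w := by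
  set c := starRingEnd ℂ
  have hw := w.im_pos
  have hz := z.im_pos
  have hFw := hm w hw
  have hne : ∀ u ∈ Metric.ball (0 : ℂ) 1, 1 - u ≠ 0 := by
    intro u hu h
    rw [← sub_eq_zero.1 h] at hu
    simp at hu
  have hww : (w : ℂ) - c w ≠ 0 := sub_conj_ne_zero hw hw
  -- `B` is the inverse of the Cayley transform `z ↦ (z - w) / (z - c w)`.
  set B : ℂ → ℂ := fun u => (w - c w * u) / (1 - u)
  have hB1 : ∀ u ∈ Metric.ball (0 : ℂ) 1, B u - w = u * (w - c w) / (1 - u) := fun u hu => by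
    have := hne u hu
    simp only [B]
    field_simp
    ring
  have hB2 : ∀ u ∈ Metric.ball (0 : ℂ) 1, B u - c w = (w - c w) / (1 - u) := fun u hu => by
    have := hne u hu
    simp only [B]
    field_simp
    ring
  have hBim : ∀ u ∈ Metric.ball (0 : ℂ) 1, 0 < (B u).im := fun u hu => by
    rw [← norm_sub_lt_norm_sub_conj_iff hw, hB1 u hu, hB2 u hu, mul_div_assoc, norm_mul]
    have h1 : 0 < ‖(w - c w) / (1 - u)‖ := norm_pos_iff.2 (div_ne_zero hww (hne u hu))
    have h2 : ‖u‖ < 1 := mem_ball_zero_iff.1 hu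
    nlinarith
  set G : ℂ → ℂ := fun u => (F (B u) - F w) / (F (B u) - c (F w))
  have hB0 : B 0 = w := by simp [B]
  have hGd : DifferentiableOn ℂ G (Metric.ball 0 1) := by
    intro u hu
    apply DifferentiableAt.differentiableWithinAt
    have h1 : DifferentiableAt ℂ B u := by
      refine DifferentiableAt.fun_div (by fun_prop) (by fun_prop) (hne u hu)
    have h2 : DifferentiableAt ℂ (fun u => F (B u)) u := (hd _ (hBim u hu)).comp u h1
    exact (h2.sub_const _).fun_div (h2.sub_const _) (sub_conj_ne_zero (hm _ (hBim u hu)) hFw)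
  have hGm : MapsTo G (Metric.ball 0 1) (Metric.closedBall 0 1) := by
    intro u hu
    have h1 := hm _ (hBim u hu)
    rw [mem_closedBall_zero_iff, norm_div, div_le_one (norm_pos_iff.2 (sub_conj_ne_zero h1 hFw))]
    exact ((norm_sub_lt_norm_sub_conj_iff hFw).2 h1).le
  have hG0 : G 0 = 0 := by simp [G, hB0]
  set u : ℂ := (z - w) / (z - c w)
  have hzw := sub_conj_ne_zero hz hw
  have hu : ‖u‖ < 1 := by
    rw [norm_div, div_lt_one (norm_pos_iff.2 hzw)]
    exact (norm_sub_lt_norm_sub_conj_iff hw).2 hz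
  have hBu : B u = z := by
    have h1 : 1 - u = (w - c w) / (z - c w) := by
      simp only [u]
      rw [eq_div_iff hzw, sub_mul, div_mul_cancel₀ _ hzw]
      ring
    have h2 : (w : ℂ) - c w * u = z * (1 - u) := by
      have h3 : u * (z - c w) = z - w := div_mul_cancel₀ _ hzw
      linear_combination h3
    simp only [B]
    rw [h2, mul_div_cancel_right₀ _ (hne u (mem_ball_zero_iff.2 hu))]
  have key := Complex.norm_le_norm_of_mapsTo_ball hGd hGm hG0 hu
  have htanh : Real.tanh (dist (⟨F z, hm z hz⟩ : UpperHalfPlane) ⟨F w, hm w hw⟩ / 2) ≤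
      Real.tanh (dist z w / 2) := by
    rw [UpperHalfPlane.tanh_half_dist, UpperHalfPlane.tanh_half_dist]
    simp only [G, hBu, norm_div, u] at key
    simpa only [dist_eq_norm] using! key
  have := le_of_tanh_le_tanh htanh
  linarith

/-! ### Geodesics invariant under a homothety -/

/-- The hypothesis says that `w`, `r w`, `r² w` lie in order on a geodesic. The doubling formula for
`sinh` reduces it to `D = (1 + r) * w.im`, while a direct computation of `D ^ 2` has the extra term
`(1 - r) ^ 2 * w.re ^ 2`. -/
theorem re_eq_zero_of_dist_eq_two_mul {w w₁ w₂ : UpperHalfPlane} {r : ℝ} (h0 : 0 < r) (h1 : r < 1)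
    (hw₁ : (w₁ : ℂ) = r * w) (hw₂ : (w₂ : ℂ) = r * w₁) (hd : dist w w₂ = 2 * dist w w₁) :
    w.re = 0 := by
  have hy := w.im_pos
  have him₁ : w₁.im = r * w.im := by
    have := congrArg Complex.im hw₁
    simpa using this
  have him₂ : w₂.im = r * w₁.im := by
    have := congrArg Complex.im hw₂
    simpa using this
  have hsq : √(w.im * w₂.im) = r * w.im := by
    rw [him₂, him₁, show w.im * (r * (r * w.im)) = (r * w.im) ^ 2 by ring,
      Real.sqrt_sq (by positivity)]
  have hsq₁ : √(w.im * w₁.im) ^ 2 = r * w.im ^ 2 := by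
    rw [Real.sq_sqrt (by rw [him₁]; positivity), him₁]
    ring
  have hsq₁' : 0 < √(w.im * w₁.im) := Real.sqrt_pos.2 (by rw [him₁]; positivity)
  have hn : 0 < ‖(w : ℂ)‖ := norm_pos_iff.2 w.ne_zero
  have hd₁ : dist (w : ℂ) w₁ = (1 - r) * ‖(w : ℂ)‖ := by
    rw [hw₁, dist_eq_norm, show (w : ℂ) - r * w = ((1 - r : ℝ) : ℂ) * w by push_cast; ring,
      norm_mul, Complex.norm_real, Real.norm_of_nonneg (by linarith)]
  have hd₂ : dist (w : ℂ) w₂ = (1 - r) * (1 + r) * ‖(w : ℂ)‖ := by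
    rw [hw₂, hw₁, dist_eq_norm,
      show (w : ℂ) - r * (r * w) = (((1 - r) * (1 + r) : ℝ) : ℂ) * w by push_cast; ring,
      norm_mul, Complex.norm_real, Real.norm_of_nonneg (by nlinarith)]
  have hs := UpperHalfPlane.sinh_half_dist w w₂
  rw [hd, mul_div_assoc, Real.sinh_two_mul, UpperHalfPlane.sinh_half_dist,
    UpperHalfPlane.cosh_half_dist, hsq, hd₁, hd₂] at hs
  set D := dist (w : ℂ) ((starRingEnd ℂ) w₁)
  have hD : D = (1 + r) * w.im := by
    have h2 : 2 * ((1 - r) * ‖(w : ℂ)‖ / (2 * √(w.im * w₁.im))) * (D / (2 * √(w.im * w₁.im))) =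
        (1 - r) * ‖(w : ℂ)‖ * D / (2 * (r * w.im ^ 2)) := by
      rw [← hsq₁]
      field_simp
    have hs' : (1 - r) * ‖(w : ℂ)‖ * D / (2 * (r * w.im ^ 2)) =
        (1 - r) * (1 + r) * ‖(w : ℂ)‖ / (2 * (r * w.im)) := by
      rw [← h2]
      exact hs
    have h3 : (1 - r) * ‖(w : ℂ)‖ ≠ 0 := mul_ne_zero (by linarith) hn.ne'
    rw [div_eq_div_iff (by positivity) (by positivity)] at hs'
    have h4 : ((1 - r) * ‖(w : ℂ)‖ * (2 * r * w.im)) * D =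
      ((1 - r) * ‖(w : ℂ)‖ * (2 * r * w.im)) * ((1 + r) * w.im) := by
      linear_combination hs'
    exact mul_left_cancel₀ (mul_ne_zero h3 (by positivity)) h4
  have hD2 : D ^ 2 = (1 - r) ^ 2 * w.re ^ 2 + (1 + r) ^ 2 * w.im ^ 2 := by
    simp only [D]
    rw [hw₁, dist_eq_norm, Complex.sq_norm, Complex.normSq_apply]
    simp
    ring
  rw [hD] at hD2
  have h5 : (1 - r) ^ 2 * w.re ^ 2 = 0 := by linear_combination -hD2
  have h6 : (1 - r) ^ 2 ≠ 0 := pow_ne_zero _ (by linarith)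
  exact pow_eq_zero_iff two_ne_zero |>.1 ((mul_eq_zero.1 h5).resolve_left h6)

theorem dist_eq_dist_of_coe_eq_mul {z w z' w' : UpperHalfPlane} {r : ℝ} (hr : 0 < r)
    (hz : (z' : ℂ) = r * z) (hw : (w' : ℂ) = r * w) : dist z' w' = dist z w := by
  have h1 : z'.im = r * z.im := by simpa using congrArg Complex.im hz
  have h2 : w'.im = r * w.im := by simpa using congrArg Complex.im hw
  rw [UpperHalfPlane.dist_eq, UpperHalfPlane.dist_eq, h1, h2, hz, hw, dist_eq_norm, ← mul_sub,
    norm_mul, Complex.norm_real, Real.norm_of_nonneg hr.le, ← dist_eq_norm,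
    show r * z.im * (r * w.im) = r ^ 2 * (z.im * w.im) by ring, Real.sqrt_mul (by positivity),
    Real.sqrt_sq hr.le, mul_left_comm 2 r, mul_div_mul_left _ _ hr.ne']

/-- The only geodesic of the upper half-plane invariant under a homothety is the imaginary axis. -/
theorem range_eq_of_isometry_of_mul_mem {c : ℝ → UpperHalfPlane} (hc : Isometry c) {r : ℝ}
    (h0 : 0 < r) (h1 : r < 1) (h : ∀ t, ∃ s, (c s : ℂ) = r * c t) :
    range c = {w | w.re = 0} := by
  choose s hs using h
  have hsi : ∀ x y, |s x - s y| = |x - y| := fun x y => by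
    rw [← Real.dist_eq, ← Real.dist_eq, ← hc.dist_eq, ← hc.dist_eq,
      dist_eq_dist_of_coe_eq_mul h0 (hs x) (hs y)]
  have hre : ∀ t, (c t).re = 0 := by
    intro t
    refine re_eq_zero_of_dist_eq_two_mul h0 h1 (hs t) (hs (s t)) ?_
    rw [hc.dist_eq, hc.dist_eq, Real.dist_eq, Real.dist_eq]
    -- The induced map `s` preserves distances on the line. It is not an involution at `t`, because
    -- the homothety shrinks imaginary parts; so its two steps from `t` go in the same direction.
    have hne : s (s t) ≠ t := by
      intro h
      have e := hs (s t)
      rw [h, hs t] at e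
      have e' := congrArg Complex.im e
      simp only [Complex.mul_im, Complex.ofReal_re, Complex.ofReal_im, zero_mul, add_zero,
        UpperHalfPlane.coe_im] at e'
      have := (c t).im_pos
      nlinarith [mul_pos h0 this]
    have h2 := hsi (s t) t
    rcases abs_eq_abs.1 h2 with h3 | h3
    · rw [show t - s (s t) = 2 * (t - s t) by linarith, abs_mul, abs_two]
    · exact absurd (by linarith) hne
  ext w
  refine ⟨?_, fun hw => ?_⟩
  · rintro ⟨t, rfl⟩
    exact hre t
  · have hw : w.re = 0 := hw
    have he : ∀ x y, |Real.log (c x).im - Real.log (c y).im| = |x - y| := fun x y => by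
      rw [← Real.dist_eq, ← Real.dist_eq, ← hc.dist_eq x y,
        UpperHalfPlane.dist_of_re_eq ((hre x).trans (hre y).symm)]
    have hlog : ∀ t, Real.log (c t).im = Real.log w.im → w ∈ range c := fun t ht => by
      refine ⟨t, UpperHalfPlane.ext_re_im ((hre t).trans hw.symm) ?_⟩
      exact Real.log_injOn_pos (c t).im_pos w.im_pos ht
    -- The logarithm of the imaginary part along `c` preserves distances on the line. So one of the
    -- parameters `a`, `-a`, `0` reaches the height of `w`, according to orientation.
    set a := Real.log w.im - Real.log (c 0).im with ha
    have e1 := he a 0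
    have e2 := he (-a) 0
    have e3 := he a (-a)
    rw [sub_zero] at e1 e2
    rcases abs_eq_abs.1 e1 with h2 | h2
    · exact hlog a (by linarith)
    rcases abs_eq_abs.1 e2 with h3 | h3
    · have h4 : Real.log (c a).im - Real.log (c (-a)).im = 0 := by linarith
      rw [h4, abs_zero, eq_comm, abs_eq_zero] at e3
      exact hlog 0 (by linarith)
    · exact hlog (-a) (by linarith)

/-! ### The central line of an invariant strip -/

/-- The conformal isomorphism of the upper half-plane to the standard strip. -/
noncomputable def logStrip (L : ℝ) (w : ℂ) : ℂ := (2 * L / Real.pi : ℝ) * Complex.log (-Complex.I * w)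

/-- The conformal isomorphism of the standard strip to the upper half-plane. -/
noncomputable def expStrip (L : ℝ) (z : ℂ) : ℂ :=
  Complex.I * Complex.exp ((Real.pi / (2 * L) : ℝ) * z)

section Strip

variable {L : ℝ}

theorem logStrip_mem (hL : 0 < L) {w : ℂ} (hw : 0 < w.im) : logStrip L w ∈ standardStrip L := by
  have h1 : |(-Complex.I * w).arg| < Real.pi / 2 := by
    rw [Complex.abs_arg_lt_pi_div_two_iff]
    left
    simpa using hw
  change |(logStrip L w).im| < L
  rw [logStrip, Complex.im_ofReal_mul, Complex.log_im,
    abs_mul, abs_of_pos (by positivity)]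
  calc 2 * L / Real.pi * |(-Complex.I * w).arg| < 2 * L / Real.pi * (Real.pi / 2) := by gcongr
    _ = L := by field_simp

theorem expStrip_im_pos (hL : 0 < L) {z : ℂ} (hz : z ∈ standardStrip L) :
    0 < (expStrip L z).im := by
  have hz : |z.im| < L := hz
  rw [expStrip, Complex.I_mul_im, Complex.exp_re, Complex.im_ofReal_mul]
  refine mul_pos (Real.exp_pos _) (Real.cos_pos_of_mem_Ioo (abs_lt.1 ?_))
  rw [abs_mul, abs_of_pos (by positivity)]
  calc Real.pi / (2 * L) * |z.im| < Real.pi / (2 * L) * L := by gcongr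
    _ = Real.pi / 2 := by field_simp

theorem expStrip_logStrip (hL : 0 < L) {w : ℂ} (hw : w ≠ 0) : expStrip L (logStrip L w) = w := by
  have hpi := Real.pi_pos.ne'
  rw [expStrip, logStrip, ← mul_assoc, ← Complex.ofReal_mul,
    show Real.pi / (2 * L) * (2 * L / Real.pi) = 1 by field_simp, Complex.ofReal_one, one_mul,
    Complex.exp_log (by simpa using hw)]
  rw [← mul_assoc, mul_neg, Complex.I_mul_I]
  ring

theorem logStrip_expStrip (hL : 0 < L) {z : ℂ} (hz : z ∈ standardStrip L) :
    logStrip L (expStrip L z) = z := by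
  have hpi := Real.pi_pos
  have hz : |z.im| < L := hz
  have hb : |Real.pi / (2 * L) * z.im| < Real.pi := by
    rw [abs_mul, abs_of_pos (by positivity)]
    calc Real.pi / (2 * L) * |z.im| < Real.pi / (2 * L) * L := by gcongr
      _ = Real.pi / 2 := by field_simp
      _ < Real.pi := by linarith
  rw [logStrip, expStrip, ← mul_assoc, neg_mul, Complex.I_mul_I, neg_neg, one_mul,
    Complex.log_exp (by rw [Complex.im_ofReal_mul]; exact (abs_lt.1 hb).1)
      (by rw [Complex.im_ofReal_mul]; exact (abs_lt.1 hb).2.le), ← mul_assoc, ← Complex.ofReal_mul,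
    show 2 * L / Real.pi * (Real.pi / (2 * L)) = 1 by field_simp, Complex.ofReal_one, one_mul]

theorem differentiableAt_logStrip {w : ℂ} (hw : 0 < w.im) : DifferentiableAt ℂ (logStrip L) w := by
  have : -Complex.I * w ∈ Complex.slitPlane := Or.inl (by simpa using hw)
  exact ((differentiableAt_id.const_mul (-Complex.I)).clog this).const_mul _

/-- In the half-plane the dynamics of the strip becomes a contracting homothety when `L > 0`. -/
theorem expStrip_sub_one (z : ℂ) :
    expStrip L (z - 1) = (Real.exp (-(Real.pi / (2 * L))) : ℝ) * expStrip L z := by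
  rw [expStrip, expStrip, Complex.ofReal_exp, mul_left_comm, ← Complex.exp_add]
  congr 2
  push_cast
  ring

theorem isConformalIso_comp_logStrip (hL : 0 < L) {h : ℂ → OnePoint ℂ} {A : Set (OnePoint ℂ)}
    (hh : IsConformalIso h (standardStrip L) A) :
    IsConformalIso (fun w => h (logStrip L w)) {z | 0 < z.im} A := by
  obtain ⟨hol, hi, rfl⟩ := hh
  have hne : ∀ w : ℂ, 0 < w.im → w ≠ 0 := by
    rintro w hw rfl
    exact lt_irrefl _ hw
  refine ⟨hol.comp (fun z hz => differentiableAt_logStrip hz) fun z hz => logStrip_mem hL hz,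
    fun z hz w hw hzw => ?_, ?_⟩
  · rw [← expStrip_logStrip hL (hne z hz), ← expStrip_logStrip hL (hne w hw),
      hi (logStrip_mem hL hz) (logStrip_mem hL hw) hzw]
  · ext p
    constructor
    · rintro ⟨w, hw, rfl⟩
      exact mem_image_of_mem _ (logStrip_mem hL hw)
    · rintro ⟨z, hz, rfl⟩
      exact ⟨expStrip L z, expStrip_im_pos hL hz, by simp only [logStrip_expStrip hL hz]⟩

theorem logStrip_of_re_eq_zero {w : ℂ} (hw : 0 < w.im) (hre : w.re = 0) :
    logStrip L w = ((2 * L / Real.pi * Real.log w.im : ℝ) : ℂ) := by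
  have : -Complex.I * w = (w.im : ℂ) := by
    apply Complex.ext <;> simp [hre]
  rw [logStrip, this, ← Complex.ofReal_log hw.le, Complex.ofReal_mul]

theorem image_logStrip_eq (hL : 0 < L) (h : ℂ → OnePoint ℂ) :
    (fun w : UpperHalfPlane => h (logStrip L w)) '' {w | w.re = 0} = range fun x : ℝ => h x := by
  ext p
  constructor
  · rintro ⟨w, hw, rfl⟩
    exact ⟨_, congrArg h (logStrip_of_re_eq_zero w.im_pos hw).symm⟩
  · rintro ⟨x, rfl⟩
    have hx := ofReal_mem_standardStrip hL x
    refine ⟨⟨expStrip L x, expStrip_im_pos hL hx⟩, ?_, ?_⟩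
    · change (expStrip L x).re = 0
      rw [expStrip, ← Complex.ofReal_mul, ← Complex.ofReal_exp, Complex.I_mul_re, Complex.ofReal_im, neg_zero]
    · exact congrArg h (logStrip_expStrip hL hx)

theorem isSimplyConnected_image_standardStrip (hL : 0 < L) {h : ℂ → OnePoint ℂ}
    (hh : HolomorphicOn h (standardStrip L)) (hi : InjOn h (standardStrip L)) :
    IsSimplyConnected (h '' standardStrip L) := by
  have hS := isOpen_standardStrip L
  have : ContractibleSpace (standardStrip L) :=
    (convex_standardStrip L).contractibleSpace ⟨0, by simpa using ofReal_mem_standardStrip hL 0⟩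
  have hopen : IsOpenMap ((standardStrip L).domRestrict h) := by
    intro V hV
    have h1 : (standardStrip L).domRestrict h '' V = h '' (Subtype.val '' V) := by
      rw [image_image]
      rfl
    rw [h1]
    exact hh.isOpen_image hi (hS.isOpenMap_subtype_val V hV) (Subtype.coe_image_subset _ V)
  have hemb : IsEmbedding ((standardStrip L).domRestrict h) :=
    (IsOpenEmbedding.of_continuous_injective_isOpenMap hh.1.domRestrict hi.injective hopen).isEmbedding
  have h2 : SimplyConnectedSpace (range ((standardStrip L).domRestrict h)) :=
    hemb.toHomeomorph.toHomotopyEquiv.simplyConnectedSpace_iff.1 inferInstance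
  rw [range_domRestrict] at h2
  exact h2

theorem IsStripMap.isInvariantStrip (hL : 0 < L) {f : OnePoint ℂ → OnePoint ℂ}
    {h : ℂ → OnePoint ℂ} (hh : IsStripMap L f h) : IsInvariantStrip L f (h '' standardStrip L) :=
  ⟨hh.holomorphicOn.isOpen_image hh.injOn (isOpen_standardStrip L) subset_rfl,
    isSimplyConnected_image_standardStrip hL hh.holomorphicOn hh.injOn, h,
    ⟨hh.holomorphicOn, hh.injOn, rfl⟩, hh.conj⟩

theorem IsStripMap.image_range_ofReal (hL : 0 < L) {f : OnePoint ℂ → OnePoint ℂ}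
    {h : ℂ → OnePoint ℂ} (hh : IsStripMap L f h) :
    f '' range (fun x : ℝ => h x) = range fun x : ℝ => h x := by
  have hconj : ∀ x : ℝ, f (h x) = h ((x - 1 : ℝ) : ℂ) := fun x => by
    rw [hh.conj _ (ofReal_mem_standardStrip hL x)]
    push_cast
    rfl
  ext p
  constructor
  · rintro ⟨_, ⟨x, rfl⟩, rfl⟩
    exact ⟨x - 1, (hconj x).symm⟩
  · rintro ⟨x, rfl⟩
    exact ⟨_, ⟨x + 1, rfl⟩, by rw [hconj, add_sub_cancel_right]⟩

/-- The image of the real line under a strip map is the central line of the strip. -/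
theorem IsStripMap.isCentralLine (hL : 0 < L) {f : OnePoint ℂ → OnePoint ℂ} {h : ℂ → OnePoint ℂ}
    (hh : IsStripMap L f h) :
    IsCentralLine f (h '' standardStrip L) (range fun x : ℝ => h x) := by
  refine ⟨⟨fun w => h (logStrip L w), fun t => ⟨⟨0, Real.exp t⟩, Real.exp_pos t⟩,
    isConformalIso_comp_logStrip hL ⟨hh.holomorphicOn, hh.injOn, rfl⟩, ?_, ?_⟩,
    hh.image_range_ofReal hL⟩
  · refine Isometry.of_dist_eq fun x y => ?_
    refine (UpperHalfPlane.dist_of_re_eq (z := ⟨⟨0, Real.exp x⟩, Real.exp_pos x⟩)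
      (w := ⟨⟨0, Real.exp y⟩, Real.exp_pos y⟩) rfl).trans ?_
    exact congrArg₂ dist (Real.log_exp x) (Real.log_exp y)
  · rw [← image_logStrip_eq hL h]
    ext p
    constructor
    · rintro ⟨w, hw, rfl⟩
      refine ⟨Real.log w.im, ?_⟩
      have : (w : ℂ) = ⟨0, Real.exp (Real.log w.im)⟩ := by
        rw [Real.exp_log w.im_pos]
        exact Complex.ext hw rfl
      simp only [this]
    · rintro ⟨t, rfl⟩
      exact ⟨⟨⟨0, Real.exp t⟩, Real.exp_pos t⟩, rfl, rfl⟩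

/-- The central line of a strip is the image of the real line under any strip map. -/
theorem IsCentralLine.eq_range (hL : 0 < L) {f : OnePoint ℂ → OnePoint ℂ} {h : ℂ → OnePoint ℂ}
    {A γ : Set (OnePoint ℂ)} (hh : IsStripMap L f h) (hA : h '' standardStrip L = A)
    (hγ : IsCentralLine f A γ) : γ = range fun x : ℝ => h x := by
  obtain ⟨⟨φ, c, ⟨hφ, hφi, hφA⟩, hc, rfl⟩, hinv⟩ := hγ
  have hopen : IsOpen {z : ℂ | 0 < z.im} := isOpen_lt continuous_const Complex.continuous_im
  obtain ⟨hψ, hψi, hψA⟩ := isConformalIso_comp_logStrip hL ⟨hh.holomorphicOn, hh.injOn, hA⟩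
  set ψ : ℂ → OnePoint ℂ := fun w => h (logStrip L w)
  have hex : ∀ {α β : ℂ → OnePoint ℂ}, α '' {z | 0 < z.im} = A → β '' {z | 0 < z.im} = A →
      ∃ θ : ℂ → ℂ, MapsTo θ {z | 0 < z.im} {z | 0 < z.im} ∧ ∀ z ∈ {z | 0 < z.im}, β (θ z) = α z := by
    intro α β hα hβ
    have : ∀ z : ℂ, 0 < z.im → ∃ w : ℂ, 0 < w.im ∧ β w = α z := fun z hz => by
      have h1 : α z ∈ β '' {z | 0 < z.im} := by
        rw [hβ, ← hα]
        exact mem_image_of_mem α hz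
      exact h1
    choose! θ hθ using this
    exact ⟨θ, fun z hz => (hθ z hz).1, fun z hz => (hθ z hz).2⟩
  obtain ⟨θ, hθm, hθ⟩ := hex hφA hψA
  obtain ⟨η, hηm, hη⟩ := hex hψA hφA
  have hθd : ∀ z : ℂ, 0 < z.im → DifferentiableAt ℂ θ z := fun z hz =>
    differentiableAt_of_comp_eq hopen hopen hφ hφi hψ hψi hθm hθ hz
  have hηd : ∀ z : ℂ, 0 < z.im → DifferentiableAt ℂ η z := fun z hz =>
    differentiableAt_of_comp_eq hopen hopen hψ hψi hφ hφi hηm hη hz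
  have hηθ : ∀ z : ℂ, 0 < z.im → η (θ z) = z := fun z hz =>
    hφi (hηm (hθm hz)) hz (by rw [hη _ (hθm hz), hθ z hz])
  have hθm' : ∀ z : ℂ, 0 < z.im → 0 < (θ z).im := fun z hz => hθm hz
  set Θ : UpperHalfPlane → UpperHalfPlane := fun z => ⟨θ z, hθm' z z.im_pos⟩
  -- The transition map and its inverse are both contractions by Schwarz-Pick.
  have hΘ : Isometry Θ := by
    refine Isometry.of_dist_eq fun z w => le_antisymm
      (dist_le_dist_of_mapsTo_upperHalfPlane hθd hθm' z w) ?_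
    have h1 := dist_le_dist_of_mapsTo_upperHalfPlane hηd (fun z hz => hηm hz) (Θ z) (Θ w)
    have h2 : ∀ z : UpperHalfPlane, (⟨η (Θ z), hηm (Θ z).im_pos⟩ : UpperHalfPlane) = z := fun z =>
      UpperHalfPlane.ext (hηθ z z.im_pos)
    rwa [h2, h2] at h1
  have hψconj : ∀ w : UpperHalfPlane, f (ψ w) =
      ψ ((Real.exp (-(Real.pi / (2 * L))) : ℝ) * w) := fun w => by
    have hw := w.im_pos
    have hS := logStrip_mem hL hw
    simp only [ψ]
    have h1 := expStrip_sub_one (L := L) (logStrip L w)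
    rw [expStrip_logStrip hL w.ne_zero] at h1
    rw [hh.conj _ hS, ← h1, logStrip_expStrip hL (sub_one_mem_standardStrip hS)]
  have hψc : ∀ t, φ (c t) = ψ ((Θ ∘ c) t) := fun t => (hθ _ (c t).im_pos).symm
  have hr1 : Real.exp (-(Real.pi / (2 * L))) < 1 := by
    rw [Real.exp_lt_one_iff]
    have := Real.pi_pos
    have : 0 < Real.pi / (2 * L) := by positivity
    linarith
  have hrange := range_eq_of_isometry_of_mul_mem (hΘ.comp hc) (Real.exp_pos _) hr1 (by
    intro t
    have h1 : f (φ (c t)) ∈ range fun t => φ (c t) := by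
      rw [← hinv]
      exact mem_image_of_mem f (mem_range_self t)
    obtain ⟨s, hs⟩ := h1
    have hs : φ (c s) = f (φ (c t)) := hs
    refine ⟨s, hψi ((Θ ∘ c) s).im_pos ?_ ?_⟩
    · change 0 < (((Real.exp (-(Real.pi / (2 * L))) : ℝ) : ℂ) * ((Θ ∘ c) t : ℂ)).im
      rw [Complex.im_ofReal_mul]
      exact mul_pos (Real.exp_pos _) ((Θ ∘ c) t).im_pos
    · rw [← hψconj, ← hψc, ← hψc, hs])
  rw [← image_logStrip_eq hL h, ← hrange, ← range_comp]
  exact congrArg range (funext hψc)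

end Strip

/-! ### Hausdorff limits of central lines -/

theorem mem_of_tendsto_of_hausdorffEDist {X ι : Type*} [MetricSpace X] {l : Filter ι} [l.NeBot]
    {γ : ι → Set X} {Γ : Set X} (hΓ : IsClosed Γ)
    (hlim : Tendsto (fun i => Metric.hausdorffEDist (closure (γ i)) Γ) l (𝓝 0)) {p : ι → X} {p₀ : X}
    (hp : ∀ i, p i ∈ γ i) (hp₀ : Tendsto p l (𝓝 p₀)) : p₀ ∈ Γ := by
  rw [Metric.mem_iff_infEDist_zero_of_closed hΓ, ← nonpos_iff_eq_zero]
  have h1 : Tendsto (fun i => Metric.hausdorffEDist (closure (γ i)) Γ + edist p₀ (p i)) l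
      (𝓝 (0 + 0)) := by
    refine hlim.add ?_
    have := (tendsto_iff_edist_tendsto_0.1 hp₀)
    simpa only [edist_comm] using this
  rw [add_zero] at h1
  refine ge_of_tendsto' h1 fun i => ?_
  refine (Metric.infEDist_le_infEDist_add_edist (y := p i)).trans ?_
  gcongr
  exact Metric.infEDist_le_hausdorffEDist_of_mem (subset_closure (hp i))

theorem exists_tendsto_of_hausdorffEDist {X : Type*} [MetricSpace X]
    {γ : ℕ → Set X} {Γ : Set X} (hne : ∀ n, (γ n).Nonempty)
    (hlim : Tendsto (fun n => Metric.hausdorffEDist (closure (γ n)) Γ) atTop (𝓝 0)) {p₀ : X}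
    (hp₀ : p₀ ∈ Γ) : ∃ p : ℕ → X, (∀ n, p n ∈ γ n) ∧ Tendsto p atTop (𝓝 p₀) := by
  -- The distance to `γ n` need not be attained, hence the slack tending to zero.
  have h1 : ∀ n : ℕ, ∃ p ∈ γ n, edist p₀ p <
      Metric.infEDist p₀ (γ n) + ((n : ENNReal) + 1)⁻¹ := fun n => by
    refine Metric.infEDist_lt_iff.1 (ENNReal.lt_add_right (Metric.infEDist_ne_top (hne n)) ?_)
    exact ENNReal.inv_ne_zero.2 (by finiteness)
  choose p hp hlt using h1
  refine ⟨p, hp, tendsto_iff_edist_tendsto_0.2 ?_⟩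
  have h2 : Tendsto (fun n : ℕ => ((n : ENNReal) + 1)⁻¹) atTop (𝓝 0) := by
    have := (tendsto_add_atTop_iff_nat 1).2 ENNReal.tendsto_inv_nat_nhds_zero
    simpa using this
  have h3 := hlim.add h2
  rw [add_zero] at h3
  refine tendsto_of_tendsto_of_tendsto_of_le_of_le tendsto_const_nhds h3 (fun n => zero_le)
    fun n => ?_
  change edist (p n) p₀ ≤ _
  rw [edist_comm]
  refine (hlt n).le.trans ?_
  gcongr
  rw [← Metric.infEDist_closure, Metric.hausdorffEDist_comm]
  exact Metric.infEDist_le_hausdorffEDist_of_mem hp₀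

/-- The first time at which a continuous function reaches a given level. -/
theorem exists_first_eq {D : ℝ → ℝ} (hD : Continuous D) {m r : ℝ} (hm : 0 ≤ m) (h0 : D 0 < r)
    (h1 : r < D m) : ∃ x, 0 ≤ x ∧ D x = r ∧ ∀ y, 0 ≤ y → y ≤ x → D y ≤ r := by
  have hK : IsCompact (Icc 0 m ∩ {x | r ≤ D x}) :=
    isCompact_Icc.inter_right (isClosed_le continuous_const hD)
  obtain ⟨x, ⟨hx, hxr⟩, hmin⟩ := hK.exists_isLeast ⟨m, ⟨hm, le_rfl⟩, h1.le⟩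
  have hxr : r ≤ D x := hxr
  obtain ⟨y, hy, hyr⟩ := intermediate_value_Icc hx.1 hD.continuousOn ⟨h0.le, hxr⟩
  have hyx : y = x := le_antisymm hy.2 (hmin ⟨⟨hy.1, hy.2.trans hx.2⟩, hyr.ge⟩)
  rw [hyx] at hyr
  refine ⟨x, hx.1, hyr, fun z hz hzx => ?_⟩
  by_contra! hlt
  have hxz := hmin ⟨⟨hz, hzx.trans hx.2⟩, hlt.le⟩
  rw [le_antisymm hzx hxz, hyr] at hlt
  exact lt_irrefl _ hlt

section Limit

variable {U : Ultrafilter ℕ} {L : ℝ} {f : ℕ → OnePoint ℂ → OnePoint ℂ}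
  {g : OnePoint ℂ → OnePoint ℂ}

/-- If strip maps start near a fixed point `p` and leave a neighbourhood of it in one direction,
then the limit of the strip maps based at the exit points has `p` in the closure of its central
line. -/
theorem exists_limitMap_mem_closure (hL : 0 < L)
    (hf : ∀ n, ∃ d, 2 ≤ d ∧ IsRationalMap d (f n)) (hg : ∃ d, 2 ≤ d ∧ IsRationalMap d g)
    (hfg : TendstoUniformly f g U) {h : ℕ → ℂ → OnePoint ℂ} (hh : ∀ n, IsStripMap L (f n) (h n))
    {p q : OnePoint ℂ} (hp : g p = p) (hpq : q ≠ p) {t s : ℕ → ℝ}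
    (ht : Tendsto (fun n => h n (t n)) U (𝓝 p)) (hs : Tendsto (fun n => h n (s n)) U (𝓝 q))
    {σ : ℝ} (hσ : σ = 1 ∨ σ = -1) (hst : ∀ᶠ n in (U : Filter ℕ), 0 ≤ σ * (s n - t n)) :
    ∃ τ : ℕ → ℝ, IsStripMap L g (limitMap U fun n z => h n (z + τ n)) ∧
      p ∈ closure (range fun x : ℝ => limitMap U (fun n z => h n (z + τ n)) x) := by
  have hσ2 : σ * σ = 1 := by rcases hσ with rfl | rfl <;> norm_num
  have h0S : (0 : ℂ) ∈ standardStrip L := by simpa using ofReal_mem_standardStrip hL 0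
  -- Fixed points of `g` are finite in number, so a closed ball around `p` can contain no other one
  -- and exclude `q`.
  obtain ⟨r, hr, hrq, hfix⟩ : ∃ r > 0, r < dist q p ∧ ∀ x, dist x p ≤ r → g x = x → x = p := by
    obtain ⟨d, hd, hgd⟩ := hg
    have hcl : IsClosed (Function.fixedPoints g \ {p}) :=
      ((hgd.finite_fixedPoints hd).subset sdiff_subset).isClosed
    obtain ⟨r, hr, hball⟩ := Metric.nhds_basis_closedBall.mem_iff.1
      (hcl.isOpen_compl.mem_nhds (by simp : p ∈ (Function.fixedPoints g \ {p})ᶜ))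
    have hqp := dist_pos.2 hpq
    refine ⟨min r (dist q p / 2), lt_min hr (by linarith),
      (min_le_right _ _).trans_lt (by linarith), fun x hx hgx => ?_⟩
    by_contra hne
    exact hball (Metric.mem_closedBall.2 (hx.trans (min_le_left _ _))) ⟨hgx, hne⟩
  have hcont : ∀ n, Continuous fun x : ℝ => dist (h n ((t n + σ * x : ℝ) : ℂ)) p := fun n => by
    refine Continuous.dist ?_ continuous_const
    exact (hh n).holomorphicOn.1.comp_continuous (by fun_prop)
      fun x => ofReal_mem_standardStrip hL _
  -- The walk goes from `t n` in the direction `σ`, and `x n` is the time of first exit. The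
  -- conditions sit inside the existential because they hold only eventually.
  have hexit : ∀ n, ∃ x : ℝ, 0 ≤ σ * (s n - t n) → dist (h n (t n)) p < r →
      r < dist (h n (s n)) p → 0 ≤ x ∧ dist (h n ((t n + σ * x : ℝ) : ℂ)) p = r ∧
        ∀ y, 0 ≤ y → y ≤ x → dist (h n ((t n + σ * y : ℝ) : ℂ)) p ≤ r := by
    intro n
    by_cases hn : 0 ≤ σ * (s n - t n) ∧ dist (h n (t n)) p < r ∧ r < dist (h n (s n)) p
    · obtain ⟨x, hx⟩ := exists_first_eq (hcont n) (r := r) hn.1 (by simpa using hn.2.1) (by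
        rw [← mul_assoc, hσ2, one_mul, add_sub_cancel]
        exact hn.2.2)
      exact ⟨x, fun _ _ _ => hx⟩
    · exact ⟨0, fun h1 h2 h3 => absurd ⟨h1, h2, h3⟩ hn⟩
  choose x hx using hexit
  have hxev : ∀ᶠ n in (U : Filter ℕ), 0 ≤ x n ∧ dist (h n ((t n + σ * x n : ℝ) : ℂ)) p = r ∧
      ∀ y, 0 ≤ y → y ≤ x n → dist (h n ((t n + σ * y : ℝ) : ℂ)) p ≤ r := by
    filter_upwards [hst, Metric.tendsto_nhds.1 ht r hr,
      (hs.dist tendsto_const_nhds).eventually_const_lt hrq] with n h1 h2 h3 using hx n h1 h2 h3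
  have hT0 : limitMap U (fun n z => h n (z + t n)) 0 = p :=
    tendsto_nhds_unique (tendsto_limitMap U _ 0) (by simpa using ht)
  have hTconst : ∀ z ∈ standardStrip L, limitMap U (fun n z => h n (z + t n)) z = p := by
    rcases isStripMap_limitMap_or_const hf hg hfg (fun n => (hh n).translate (t n)) with
      hstrip | ⟨p', -, hp'⟩
    · exact absurd (by rw [hT0, hp]) (hstrip.map_ne_self h0S)
    · rw [hp' 0 h0S] at hT0
      rwa [hT0] at hp'
  -- Based at `t n`, the limit is constantly `p`, so on each bounded time interval the walk is
  -- eventually within `r` of `p`: exit times tend to infinity.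
  have hxlarge : ∀ M : ℝ, ∀ᶠ n in (U : Filter ℕ), M < x n := by
    intro M
    have hl := tendstoLocallyUniformlyOn_limitMap hf hg hfg (fun n => (hh n).translate (t n))
    have hK : IsCompact ((fun y : ℝ => ((σ * y : ℝ) : ℂ)) '' Icc 0 M) :=
      isCompact_Icc.image (by fun_prop)
    have hKS : (fun y : ℝ => ((σ * y : ℝ) : ℂ)) '' Icc 0 M ⊆ standardStrip L := by
      rintro _ ⟨y, -, rfl⟩
      exact ofReal_mem_standardStrip hL _
    have hunif := (tendstoLocallyUniformlyOn_iff_forall_isCompact (isOpen_standardStrip L)).1 hl _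
      hKS hK
    filter_upwards [hxev, Metric.tendstoUniformlyOn_iff.1 hunif r hr] with n hn hn'
    by_contra! hle
    have h1 := hn' _ (mem_image_of_mem _ (⟨hn.1, hle⟩ : x n ∈ Icc 0 M))
    rw [hTconst _ (ofReal_mem_standardStrip hL _), dist_comm, ← Complex.ofReal_add, add_comm,
      hn.2.1] at h1
    exact lt_irrefl _ h1
  set τ : ℕ → ℝ := fun n => t n + σ * x n
  set k := limitMap U fun n z => h n (z + τ n)
  have hk0 : dist (k 0) p = r := by
    refine tendsto_nhds_unique ((tendsto_limitMap U _ 0).dist tendsto_const_nhds)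
      (tendsto_const_nhds.congr' ?_)
    filter_upwards [hxev] with n hn
    rw [zero_add, hn.2.1]
  -- A constant limit would be a fixed point at distance exactly `r` from `p`, which `hfix`
  -- excludes.
  have hk : IsStripMap L g k := by
    rcases isStripMap_limitMap_or_const hf hg hfg (fun n => (hh n).translate (τ n)) with
      hstrip | ⟨p', hp', hconst⟩
    · exact hstrip
    · have e : k 0 = p' := hconst 0 h0S
      rw [e] at hk0
      rw [hfix p' hk0.le hp', dist_self] at hk0
      exact absurd hk0 hr.ne
  refine ⟨τ, hk, ?_⟩
  -- Time `y` before the exit still lies after the start of the walk, as the exit times are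
  -- unbounded.
  have hkr : ∀ y : ℝ, 0 ≤ y → dist (k ((-(σ * y) : ℝ) : ℂ)) p ≤ r := by
    intro y hy
    refine le_of_tendsto ((tendsto_limitMap U _ _).dist tendsto_const_nhds) ?_
    filter_upwards [hxev, hxlarge y] with n hn hn'
    rw [← Complex.ofReal_add, show -(σ * y) + τ n = t n + σ * (x n - y) by simp only [τ]; ring]
    exact hn.2.2 _ (by linarith) (by linarith)
  have hσtend : Tendsto (fun y : ℝ => -(σ * y)) atTop (cocompact ℝ) := by
    rw [cocompact_eq_atBot_atTop]
    rcases hσ with rfl | rfl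
    · simpa using (tendsto_neg_atTop_atBot (G := ℝ)).mono_right le_sup_left
    · simpa using! (tendsto_id (α := ℝ)).mono_right (le_sup_right (a := atBot))
  set W := Ultrafilter.of (atTop : Filter ℝ)
  have hW : (W : Filter ℝ) ≤ atTop := Ultrafilter.of_le _
  obtain ⟨p', hp', htend⟩ := hk.exists_tendsto_fixed hL hg (V := W.map fun y => -(σ * y))
    (hσtend.mono_left hW)
  have htend' : Tendsto (fun y : ℝ => k ((-(σ * y) : ℝ) : ℂ)) W (𝓝 p') :=
    htend.comp (tendsto_map (f := fun y : ℝ => -(σ * y)))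
  have hp'p : p' = p := by
    refine hfix p' ?_ hp'
    refine le_of_tendsto (htend'.dist tendsto_const_nhds) ?_
    filter_upwards [hW (eventually_ge_atTop (0 : ℝ))] with y hy using hkr y hy
  rw [← hp'p]
  exact mem_closure_of_tendsto htend' (.of_forall fun y => mem_range_self _)

end Limit

end RiemannSphere

/-! ### Assembling the strips of the limit map -/

open RiemannSphere in
theorem mainTheorem9 (L : ℝ) (hL : 0 < L)
    (f : ℕ → OnePoint ℂ → OnePoint ℂ) (g : OnePoint ℂ → OnePoint ℂ)
    (hf : ∀ n, ∃ d, 2 ≤ d ∧ RiemannSphere.IsRationalMap d (f n))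
    (hg : ∃ d, 2 ≤ d ∧ RiemannSphere.IsRationalMap d g)
    (hfg : TendstoUniformly f g atTop)
    (A γ : ℕ → Set (OnePoint ℂ))
    (hA : ∀ n, RiemannSphere.IsInvariantStrip L (f n) (A n))
    (hγ : ∀ n, RiemannSphere.IsCentralLine (f n) (A n) (γ n))
    (Γ : Set (OnePoint ℂ)) (hΓ : IsCompact Γ)
    (hlim : Tendsto (fun n => Metric.hausdorffEDist (closure (γ n)) Γ) atTop (𝓝 0))
    (hpt : ∀ p, Γ ≠ {p}) :
    ∃ (E : Type) (S ℓ : E → Set (OnePoint ℂ)),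
      Nonempty E ∧ Countable E ∧
      (∀ e, RiemannSphere.IsInvariantStrip L g (S e)) ∧
      (∀ e, RiemannSphere.IsCentralLine g (S e) (ℓ e)) ∧
      Pairwise (fun e e' => Disjoint (S e) (S e')) ∧
      Γ \ Function.fixedPoints g = ⋃ e, ℓ e ∧
      Γ = ⋃ e, closure (ℓ e) := by
  have h0S : (0 : ℂ) ∈ standardStrip L := by simpa using ofReal_mem_standardStrip hL 0
  choose h hiso hconj using fun n => (hA n).2.2
  have hh : ∀ n, IsStripMap L (f n) (h n) := fun n => ⟨(hiso n).1, (hiso n).2.1, hconj n⟩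
  have hγr : ∀ n, γ n = range fun x : ℝ => h n x := fun n =>
    (hγ n).eq_range hL (hh n) (hiso n).2.2
  have hmemγ : ∀ n (x : ℝ), h n x ∈ γ n := fun n x => by
    rw [hγr n]
    exact mem_range_self x
  set U := Ultrafilter.of (atTop : Filter ℕ)
  have hU : (U : Filter ℕ) ≤ atTop := Ultrafilter.of_le _
  have hfgU : TendstoUniformly f g U := fun s hs => hU (hfg s hs)
  set T : (ℕ → ℝ) → ℂ → OnePoint ℂ := fun t => limitMap U fun n z => h n (z + t n)
  have halt : ∀ t, IsStripMap L g (T t) ∨ ∃ p, g p = p ∧ ∀ z ∈ standardStrip L, T t z = p :=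
    fun t => isStripMap_limitMap_or_const hf hg hfgU fun n => (hh n).translate (t n)
  have hTΓ : ∀ t (x : ℝ), T t x ∈ Γ := fun t x => by
    refine mem_of_tendsto_of_hausdorffEDist (γ := γ) hΓ.isClosed (hlim.mono_left hU)
      (fun n => hmemγ n (x + t n)) ?_
    simpa using tendsto_limitMap U (fun n z => h n (z + t n)) x
  have hseq : ∀ p ∈ Γ, ∃ t : ℕ → ℝ, Tendsto (fun n => h n (t n)) U (𝓝 p) := by
    intro p hp
    obtain ⟨y, hy, hyp⟩ := exists_tendsto_of_hausdorffEDist (fun n => ⟨_, hmemγ n 0⟩) hlim hp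
    have : ∀ n, ∃ x : ℝ, h n x = y n := fun n => by
      have := hy n
      rwa [hγr n] at this
    choose t ht using this
    exact ⟨t, by simpa only [ht] using hyp.mono_left hU⟩
  have hoverlap : ∀ {t t'}, IsStripMap L g (T t) → IsStripMap L g (T t') → ∀ {z z'},
      z ∈ standardStrip L → z' ∈ standardStrip L → T t z = T t' z' →
      ∃ c : ℝ, ∀ x ∈ standardStrip L, T t' x = T t (x + c) := fun ht ht' _ _ hz hz' heq =>
    exists_translate_of_limitMap_eq hf hg hfgU hh ht ht' hz hz' heq
  -- Indexing by image sets, not by sequences of shifts, identifies limits that differ by a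
  -- translation. Overlapping images coincide, so distinct indices give disjoint strips.
  let E : Type := {B : Set (OnePoint ℂ) // ∃ t, IsStripMap L g (T t) ∧ T t '' standardStrip L = B}
  have hE : ∀ e : E, ∃ t, IsStripMap L g (T t) ∧ T t '' standardStrip L = e.1 := fun e => e.2
  choose t ht hte using hE
  -- The chosen representative of an image may differ from `T t'`, but only by a real translation,
  -- which preserves the real axis.
  have hline : ∀ t', IsStripMap L g (T t') → ∃ e : E,
      range (fun x : ℝ => T t' x) ⊆ range fun x : ℝ => T (t e) x := by
    intro t' ht'
    set e : E := ⟨_, t', ht', rfl⟩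
    have h1 : T t' 0 ∈ T (t e) '' standardStrip L := by
      rw [hte e]
      exact mem_image_of_mem _ h0S
    obtain ⟨z, hz, hze⟩ := h1
    obtain ⟨c, hc⟩ := hoverlap (ht e) ht' hz h0S hze
    refine ⟨e, ?_⟩
    rintro _ ⟨x, rfl⟩
    refine ⟨x + c, ?_⟩
    simp only [hc x (ofReal_mem_standardStrip hL x), Complex.ofReal_add]
  have hdisj : Pairwise fun e e' : E => Disjoint e.1 e'.1 := by
    intro e e' hne
    rw [Set.disjoint_left]
    intro p hp hp'
    rw [← hte e] at hp
    rw [← hte e'] at hp'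
    obtain ⟨z, hz, rfl⟩ := hp
    obtain ⟨z', hz', heq⟩ := hp'
    have hsub : ∀ {e e' : E} {z z'}, z ∈ standardStrip L → z' ∈ standardStrip L →
        T (t e) z = T (t e') z' → e'.1 ⊆ e.1 := by
      intro e e' z z' hz hz' heq
      obtain ⟨c, hc⟩ := hoverlap (ht e) (ht e') hz hz' heq
      rw [← hte e, ← hte e']
      rintro _ ⟨x, hx, rfl⟩
      exact ⟨x + c, add_ofReal_mem_standardStrip hx c, (hc x hx).symm⟩
    exact hne (Subtype.ext (Subset.antisymm (hsub hz' hz heq) (hsub hz hz' heq.symm)))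
  have hstrip : ∀ e : E, IsInvariantStrip L g e.1 := fun e => by
    rw [← hte e]
    exact (ht e).isInvariantStrip hL
  have hcover : ∀ p ∈ Γ, g p ≠ p → ∃ e : E, p ∈ range fun x : ℝ => T (t e) x := by
    intro p hp hgp
    obtain ⟨t', ht'⟩ := hseq p hp
    have hT0 : T t' 0 = p := tendsto_nhds_unique (tendsto_limitMap U _ 0) (by simpa using ht')
    rcases halt t' with hs | ⟨p', hp', hconst⟩
    · obtain ⟨e, he⟩ := hline t' hs
      exact ⟨e, he ⟨0, by simpa using hT0⟩⟩
    · rw [hconst 0 h0S] at hT0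
      rw [hT0] at hp'
      exact absurd hp' hgp
  have hcover' : ∀ p ∈ Γ, ∃ e : E, p ∈ closure (range fun x : ℝ => T (t e) x) := by
    intro p hp
    by_cases hgp : g p = p
    · obtain ⟨q, hq, hqp⟩ : ∃ q ∈ Γ, q ≠ p := by
        by_contra! hcon
        exact hpt p (Subset.antisymm hcon (singleton_subset_iff.2 hp))
      obtain ⟨a, ha⟩ := hseq p hp
      obtain ⟨b, hb⟩ := hseq q hq
      -- The ultrafilter decides on which side of `a n` the parameter `b n` lies.
      obtain ⟨σ, hσ, hab⟩ : ∃ σ : ℝ, (σ = 1 ∨ σ = -1) ∧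
          ∀ᶠ n in (U : Filter ℕ), 0 ≤ σ * (b n - a n) := by
        rcases Ultrafilter.eventually_or.1
          (.of_forall fun n => le_total (a n) (b n) : ∀ᶠ n in (U : Filter ℕ), _) with h1 | h1
        · exact ⟨1, Or.inl rfl, h1.mono fun n hn => by linarith⟩
        · exact ⟨-1, Or.inr rfl, h1.mono fun n hn => by linarith⟩
      obtain ⟨τ, hτ, hcl⟩ := exists_limitMap_mem_closure hL hf hg hfgU hh hgp hqp ha hb hσ hab
      obtain ⟨e, he⟩ := hline τ hτ
      exact ⟨e, closure_mono he hcl⟩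
    · obtain ⟨e, he⟩ := hcover p hp hgp
      exact ⟨e, subset_closure he⟩
  refine ⟨E, fun e => e.1, fun e => range fun x : ℝ => T (t e) x, ?_, ?_, hstrip, ?_, hdisj, ?_, ?_⟩
  · obtain ⟨e, -⟩ := hcover' _ (hTΓ 0 0)
    exact ⟨e⟩
  -- Disjoint nonempty open sets in a separable space.
  · have : Countable (univ : Set E) := (Set.PairwiseDisjoint.countable_of_isOpen
      (s := fun e : E => e.1) (fun e _ e' _ hne => hdisj hne) (fun e _ => (hstrip e).1)
      fun e _ => (hstrip e).2.1.nonempty).to_subtype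
    exact countable_univ_iff.1 this
  · intro e
    change IsCentralLine g e.1 _
    rw [← hte e]
    exact (ht e).isCentralLine hL
  · refine Subset.antisymm (fun p hp => mem_iUnion.2 (hcover p hp.1 hp.2)) (iUnion_subset fun e => ?_)
    rintro _ ⟨x, rfl⟩
    exact ⟨hTΓ _ x, (ht e).map_ne_self (ofReal_mem_standardStrip hL x)⟩
  · refine Subset.antisymm (fun p hp => mem_iUnion.2 (hcover' p hp)) (iUnion_subset fun e => ?_)
    refine closure_minimal ?_ hΓ.isClosed
    rintro _ ⟨x, rfl⟩
    exact hTΓ _ x
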